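/- Let $\delta\ge 1$ be an integer, $\tau=\tau_1+i\tau_2\in\mathbb C$ with $\tau_2>0$, $\Lambda=\mathbb Z\delta+\mathbb Z\tau$ and $M=\mathbb C/\Lambda$. Let $L_0\to M$ be the holomorphic line bundle with multipliers $e_\delta\equiv 1$, $e_\tau(z)=e^{-2\pi i z-\pi i\tau}$ (so that sections are entire functions with $\theta(z+\delta)=\theta(z)$, $\theta(z+\tau)=e_\tau(z)\theta(z)$), with the Hermitian metric $h_{L_0}(z)=e^{-\frac{2\pi}{\tau_2}(\operatorname{Im} z)^2}$, whose curvature is $\Theta_{L_0}=-\partial\bar\partial\log h_{L_0}$. Let $\widehat M=\mathrm{Pic}^0(M)=\mathbb C/(\mathbb Z+\mathbb Z\frac{\tau}{\delta})$, where $\hat\mu$ corresponds to the flat line bundle of the Dolbeault class $\frac{-i}{2\tau_2}\hat\mu\,d\bar z$, with multipliers $e_\lambda=e^{2\pi i\sigma\bar\lambda}$, $\sigma=\frac{-i}{2\tau_2}\hat\mu$; let $\mathrm P\to M\times\widehat M$ be the Poincaré line bundle, and let $\varphi_{L_0}:M\to\widehat M$, $[\mu]\mapsto T_\mu^*L_0\otimes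 L_0^*$ (with $T_\mu$ the translation by $\mu$), which in these coordinates is induced by the identity of $\mathbb C$. The line bundle $(Id\times\varphi_{L_0})^*\mathrm P\to M\times M$ has multipliers $1$, $e^{-2\pi i\mu}$ for the translations by $\delta,\tau$ in $z$ and $1$, $e^{-2\pi i z}$ for the translations by $\delta,\tau$ in $\mu$; it is given the metric $e^{-\frac{4\pi}{\tau_2}\operatorname{Im}z\,\operatorname{Im}\mu}$. Put $$\widetilde{E'}=\pi_1^*L_0\otimes(Id\times\varphi_{L_0})^*\mathrm P\to M\times M,$$ let $h_{\widetilde{E'}}$ be the tensor product metric $\pi_1^*h_{L_0}\otimes h_{(Id\times\varphi_{L_0})^*\mathrm P}$, and let $E'=(\pi_2)_*\widetilde{E'}\to M$, with fibres $E'_\mu=H^0(M,\widetilde{E'}|_{M\times\{\mu\}})$, carry the $L^2$-metric $h_{E'}$, $$(f,g)_\mu=\int_M h_{\widetilde{E'}}(z,\mu)\,f(z)\overline{g(z)}\;\tfrac i2\,dz\wedge d\bar z .$$ Theorem. $E'$ is a holomorphic vector bundle of rank $\delta$ on $M$, $h_{E'}$ is a smooth Hermitian metric on it, and the curvature of its Chern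 connection is $$\Theta(E',h_{E'})=-\Theta_{L_0}(\mu)\,(Id)_{\delta\times\delta}=-\frac{\pi}{\tau_2}\,d\mu\wedge d\bar\mu\,(Id)_{\delta\times\delta},$$ that is, this is the curvature matrix in every local holomorphic frame of $E'$. -/

import Mathlib

open scoped UpperHalfPlane ComplexConjugate ComplexOrder ContDiff Real

noncomputable section

namespace ThetaTorus

/-! ### Holomorphic line bundles on complex tori, by systems of multipliers -/

section Automorphy

variable {W W' : Type*} [NormedAddCommGroup W] [NormedSpace ℂ W]
  [NormedAddCommGroup W'] [NormedSpace ℂ W']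

/-- A system of multipliers `e_l ∈ 𝒪^*(W)`, `l ∈ Γ`, satisfying the compatibility relations.
It defines the holomorphic line bundle `(W × ℂ) / Γ → W / Γ`, where `l ∈ Γ` acts by
`(v, x) ↦ (v + l, e_l(v) x)`. -/
structure LineBundle (Γ : AddSubgroup W) where
  /-- the multipliers -/
  mult : Γ → W → ℂ
  holo : ∀ l, Differentiable ℂ (mult l)
  ne_zero : ∀ l v, mult l v ≠ 0
  compat : ∀ l l' v, mult (l + l') v = mult l (v + (l' : W)) * mult l' v

namespace LineBundle

variable {Γ : AddSubgroup W} {Γ' : AddSubgroup W'}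

/-- The trivial line bundle. -/
def trivial (Γ : AddSubgroup W) : LineBundle Γ where
  mult _ _ := 1
  holo _ := differentiable_const _
  ne_zero _ _ := one_ne_zero
  compat _ _ _ := by simp

/-- The tensor product `L ⊗ L'`. -/
def tensor (L L' : LineBundle Γ) : LineBundle Γ where
  mult l v := L.mult l v * L'.mult l v
  holo l := (L.holo l).mul (L'.holo l)
  ne_zero l v := mul_ne_zero (L.ne_zero l v) (L'.ne_zero l v)
  compat l l' v := by rw [L.compat, L'.compat]; ring

/-- The dual `L^*`. -/
def dual (L : LineBundle Γ) : LineBundle Γ where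
  mult l v := (L.mult l v)⁻¹
  holo l := (L.holo l).inv (L.ne_zero l)
  ne_zero l v := inv_ne_zero (L.ne_zero l v)
  compat l l' v := by rw [L.compat, mul_inv]

/-- The pull-back of a line bundle along the holomorphic map `W / Γ → W' / Γ'` induced by a linear
map `F : W → W'` with `F(Γ) ⊆ Γ'`. -/
def pullback (F : W →L[ℂ] W') (hF : ∀ l ∈ Γ, F l ∈ Γ') (L : LineBundle Γ') : LineBundle Γ where
  mult l v := L.mult ⟨F l, hF l l.2⟩ (F v)
  holo l := (L.holo _).comp F.differentiable
  ne_zero l v := L.ne_zero _ _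
  compat l l' v := by
    have h : (⟨F ((l + l' : Γ) : W), hF _ (l + l').2⟩ : Γ') =
        ⟨F l, hF l l.2⟩ + ⟨F l', hF l' l'.2⟩ := by
      ext; simp
    rw [h, L.compat]; simp

/-- The pull-back `T_a^* L` along the translation `v ↦ v + a` of `W / Γ`. -/
def translate (a : W) (L : LineBundle Γ) : LineBundle Γ where
  mult l v := L.mult l (v + a)
  holo l := (L.holo l).comp (differentiable_id.add_const a)
  ne_zero l v := L.ne_zero _ _
  compat l l' v := by rw [L.compat, add_right_comm]

/-- The restriction of a line bundle on `W/Γ × W'/Γ'` to `W/Γ × {[a]}`. -/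
def restrictLeft (L : LineBundle (Γ.prod Γ')) (a : W') : LineBundle Γ where
  mult l v := L.mult ⟨((l : W), 0), ⟨l.2, Γ'.zero_mem⟩⟩ (v, a)
  holo l := (L.holo _).comp (differentiable_id.prodMk (differentiable_const a))
  ne_zero l v := L.ne_zero _ _
  compat l l' v := by
    have h := L.compat ⟨((l : W), 0), ⟨l.2, Γ'.zero_mem⟩⟩ ⟨((l' : W), 0), ⟨l'.2, Γ'.zero_mem⟩⟩ (v, a)
    have e : (⟨((l : W), 0), ⟨l.2, Γ'.zero_mem⟩⟩ + ⟨((l' : W), 0), ⟨l'.2, Γ'.zero_mem⟩⟩ : Γ.prod Γ') =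
        ⟨(((l + l' : Γ) : W), 0), ⟨(l + l').2, Γ'.zero_mem⟩⟩ := by
      ext <;> simp
    rw [e] at h
    simpa using h

/-- The restriction of a line bundle on `W/Γ × W'/Γ'` to `{[a]} × W'/Γ'`. -/
def restrictRight (L : LineBundle (Γ.prod Γ')) (a : W) : LineBundle Γ' where
  mult l v := L.mult ⟨((0 : W), (l : W')), ⟨Γ.zero_mem, l.2⟩⟩ (a, v)
  holo l := (L.holo _).comp ((differentiable_const a).prodMk differentiable_id)
  ne_zero l v := L.ne_zero _ _
  compat l l' v := by
    have h := L.compat ⟨((0 : W), (l : W')), ⟨Γ.zero_mem, l.2⟩⟩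
      ⟨((0 : W), (l' : W')), ⟨Γ.zero_mem, l'.2⟩⟩ (a, v)
    have e : (⟨((0 : W), (l : W')), ⟨Γ.zero_mem, l.2⟩⟩ + ⟨((0 : W), (l' : W')), ⟨Γ.zero_mem, l'.2⟩⟩ :
        Γ.prod Γ') = ⟨((0 : W), ((l + l' : Γ') : W')), ⟨Γ.zero_mem, (l + l').2⟩⟩ := by
      ext <;> simp
    rw [e] at h
    simpa using h

/-- Holomorphic isomorphism of line bundles. -/
def Iso (L L' : LineBundle Γ) : Prop :=
  ∃ u : W → ℂ, Differentiable ℂ u ∧ (∀ v, u v ≠ 0) ∧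
    ∀ (l : Γ) v, u (v + (l : W)) * L.mult l v = L'.mult l v * u v

/-- `f` represents a holomorphic section of `L` over an open set of `W / Γ` whose preimage in `W`
is `S`: a holomorphic function on `S` which is quasi-periodic with the given multipliers. -/
def IsSectionOn (L : LineBundle Γ) (S : Set W) (f : W → ℂ) : Prop :=
  DifferentiableOn ℂ f S ∧ ∀ (l : Γ), ∀ v ∈ S, f (v + (l : W)) = L.mult l v * f v

/-- The space `H⁰(W / Γ, L)` of global holomorphic sections. -/
def globalSections (L : LineBundle Γ) : Submodule ℂ (W → ℂ) where
  carrier := {f | L.IsSectionOn Set.univ f}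
  zero_mem' := ⟨differentiableOn_const 0, fun _ _ _ => by simp⟩
  add_mem' {f g} hf hg := ⟨hf.1.add hg.1, fun l v hv => by
    simp only [Pi.add_apply, hf.2 l v hv, hg.2 l v hv]; ring⟩
  smul_mem' c {f} hf := ⟨hf.1.const_smul c, fun l v hv => by
    simp only [Pi.smul_apply, smul_eq_mul, hf.2 l v hv]; ring⟩

end LineBundle

/-- A smooth Hermitian metric on a line bundle: a positive function `h` on `W` such that
`h(v) |θ(v)|²` is the squared length of a section represented by `θ`. -/
structure HermitianMetric {Γ : AddSubgroup W} (L : LineBundle Γ) where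
  /-- the weight function -/
  weight : W → ℝ
  smooth : ContDiff ℝ ∞ weight
  pos : ∀ v, 0 < weight v
  compat : ∀ (l : Γ) v, weight (v + (l : W)) * ‖L.mult l v‖ ^ 2 = weight v

namespace HermitianMetric

variable {Γ : AddSubgroup W} {Γ' : AddSubgroup W'}

/-- The metric induced on a tensor product. -/
def tensor {L L' : LineBundle Γ} (h : HermitianMetric L) (h' : HermitianMetric L') :
    HermitianMetric (L.tensor L') where
  weight v := h.weight v * h'.weight v
  smooth := h.smooth.mul h'.smooth
  pos v := mul_pos (h.pos v) (h'.pos v)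
  compat l v := by
    rw [← h.compat l v, ← h'.compat l v]
    simp only [LineBundle.tensor, norm_mul]; ring

/-- The metric induced on a pull-back. -/
def pullback (F : W →L[ℂ] W') (hF : ∀ l ∈ Γ, F l ∈ Γ') {L : LineBundle Γ'}
    (h : HermitianMetric L) : HermitianMetric (L.pullback F hF) where
  weight v := h.weight (F v)
  smooth := h.smooth.comp (F.restrictScalars ℝ).contDiff
  pos v := h.pos _
  compat l v := by
    have := h.compat ⟨F l, hF l l.2⟩ (F v)
    simpa [LineBundle.pullback] using this

end HermitianMetric

end Automorphy

/-! ### Differential forms on a one-dimensional base -/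

/-- `∂f`, evaluated on the tangent vector `v`. -/
def del (f : ℂ → ℂ) (μ v : ℂ) : ℂ :=
  (fderiv ℝ f μ v - Complex.I * fderiv ℝ f μ (Complex.I * v)) / 2

/-- `∂̄f`, evaluated on the tangent vector `v`. -/
def delbar (f : ℂ → ℂ) (μ v : ℂ) : ℂ :=
  (fderiv ℝ f μ v + Complex.I * fderiv ℝ f μ (Complex.I * v)) / 2

/-- The exterior derivative of a 1-form `α` (`α μ v` is its value at `μ` on the tangent
vector `v`), evaluated on `(v, w)`. -/
def extDer (α : ℂ → ℂ → ℂ) (μ v w : ℂ) : ℂ :=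
  fderiv ℝ (fun ν => α ν w) μ v - fderiv ℝ (fun ν => α ν v) μ w

/-- The 2-form `dμ ∧ dμ̄`, evaluated on `(v, w)`. -/
def dWedgeDbar (v w : ℂ) : ℂ := v * conj w - w * conj v

/-- The curvature `-∂∂̄ log h` of a metric of weight `h` on a line bundle over a torus of dimension
one, as a 2-form; here `∂∂̄ f = d(∂̄ f)` as `∂̄∂̄ = 0`. -/
def HermitianMetric.curvature {Γ : AddSubgroup ℂ} {L : LineBundle Γ} (h : HermitianMetric L)
    (μ v w : ℂ) : ℂ :=
  -extDer (delbar fun ν => ((Real.log (h.weight ν) : ℝ) : ℂ)) μ v w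

/-- The connection matrix `∂H · H⁻¹` of the Chern connection in a holomorphic frame `(s_i)` with
Gram matrix `H_ij = (s_i, s_j)`, that is, `∇ s_i = ∑_j (∂H · H⁻¹)_ij s_j`. -/
def chernConnection {n : ℕ} (H : ℂ → Matrix (Fin n) (Fin n) ℂ) (μ v : ℂ) :
    Matrix (Fin n) (Fin n) ℂ :=
  (Matrix.of fun i j => del (fun ν => H ν i j) μ v) * (H μ)⁻¹

/-- The curvature matrix `dA - A ∧ A`, `A = ∂H · H⁻¹`, of the Chern connection in a holomorphic
frame with Gram matrix `H`, evaluated at `μ` on the tangent vectors `(v, w)`. -/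
def chernCurvature {n : ℕ} (H : ℂ → Matrix (Fin n) (Fin n) ℂ) (μ v w : ℂ) :
    Matrix (Fin n) (Fin n) ℂ :=
  (Matrix.of fun i j => extDer (fun ν u => chernConnection H ν u i j) μ v w) -
    (chernConnection H μ v * chernConnection H μ w -
      chernConnection H μ w * chernConnection H μ v)

/-! ### The torus, its dual, and the bundles on them -/

/-- The lattice `Λ = ℤ δ + ℤ τ`, in the complex coordinate `z`. -/
def lattice (δ : ℕ) (τ : ℍ) : AddSubgroup ℂ := AddSubgroup.closure {(δ : ℂ), (τ : ℂ)}

/-- The complex torus `M = ℂ / Λ`. -/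
abbrev Torus (δ : ℕ) (τ : ℍ) : Type := ℂ ⧸ lattice δ τ

/-- The lattice `ℤ + ℤ (τ/δ)` of the dual torus `M̂ = Pic⁰(M)`, in the coordinate `μ̂` for which
the class of `μ̂` is the line bundle of the Dolbeault class of `(-i / (2 Im τ)) μ̂ dz̄`. -/
def dualLattice (δ : ℕ) (τ : ℍ) : AddSubgroup ℂ := AddSubgroup.closure {(1 : ℂ), (τ : ℂ) / δ}

/-- The coefficient of `τ` of a lattice vector. -/
def tauCoord (τ : ℍ) (l : ℂ) : ℝ := l.im / τ.im

lemma tauCoord_add (τ : ℍ) (l l' : ℂ) : tauCoord τ (l + l') = tauCoord τ l + tauCoord τ l' := by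
  simp [tauCoord, add_div]

lemma exists_of_mem_lattice {δ : ℕ} {τ : ℍ} {l : ℂ} (hl : l ∈ lattice δ τ) :
    ∃ a b : ℤ, tauCoord τ l = b ∧ l = a * δ + b * τ := by
  obtain ⟨a, b, rfl⟩ := AddSubgroup.mem_closure_pair.1 hl
  refine ⟨a, b, ?_, by simp⟩
  have := τ.im_ne_zero
  simp [tauCoord, this]

lemma exists_of_mem_dualLattice {δ : ℕ} [NeZero δ] {τ : ℍ} {l : ℂ} (hl : l ∈ dualLattice δ τ) :
    ∃ a b : ℤ, (tauCoord τ l : ℂ) * δ = b ∧ l = a + tauCoord τ l * τ := by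
  obtain ⟨a, b, rfl⟩ := AddSubgroup.mem_closure_pair.1 hl
  have := τ.im_ne_zero
  have hd : (δ : ℝ) ≠ 0 := NeZero.ne _
  have hd' : (δ : ℂ) ≠ 0 := NeZero.ne _
  have h : tauCoord τ (a • (1 : ℂ) + b • ((τ : ℂ) / δ)) = b / δ := by
    have h1 : ((τ : ℂ) / δ).im = τ.im / δ := by
      rw [← Complex.ofReal_natCast, Complex.div_ofReal_im]; rfl
    simp [tauCoord, h1]; field_simp
  refine ⟨a, b, ?_, ?_⟩
  · rw [h]; push_cast; field_simp
  · rw [h]; push_cast; simp; field_simp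

/-- The line bundle `L₀ → M`, with multipliers `e_δ ≡ 1` and `e_τ(z) = exp(-2πi z - πi τ)`;
in general, `e_{aδ+bτ}(z) = exp(-2πi b z - πi b² τ)`. -/
def L₀ (δ : ℕ) (τ : ℍ) : LineBundle (lattice δ τ) where
  mult l z := Complex.exp (-2 * π * Complex.I * tauCoord τ l * z
    - π * Complex.I * (tauCoord τ l) ^ 2 * τ)
  holo l := by fun_prop
  ne_zero l z := Complex.exp_ne_zero _
  compat l l' z := by
    obtain ⟨a, b, h, -⟩ := exists_of_mem_lattice l.2
    obtain ⟨a', b', h', e'⟩ := exists_of_mem_lattice l'.2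
    rw [← Complex.exp_add, Complex.exp_eq_exp_iff_exists_int]
    refine ⟨b * a' * δ, ?_⟩
    simp only [AddSubgroup.coe_add, tauCoord_add, h, h']
    rw [e']; push_cast; ring

/-- The Poincaré line bundle `P → M × M̂`, with multipliers
`e_{(δ,0)} ≡ 1`, `e_{(τ,0)} = exp(-2πi μ̂)`, `e_{(0,1)} ≡ 1`, `e_{(0,τ/δ)} = exp(-2πi z/δ)`. -/
def poincare (δ : ℕ) [NeZero δ] (τ : ℍ) : LineBundle ((lattice δ τ).prod (dualLattice δ τ)) where
  mult l q := Complex.exp (-2 * π * Complex.I * (tauCoord τ l.1.1 * q.2 + tauCoord τ l.1.2 * q.1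
    + tauCoord τ l.1.1 * tauCoord τ l.1.2 * τ))
  holo l := by fun_prop
  ne_zero l q := Complex.exp_ne_zero _
  compat l l' q := by
    obtain ⟨a, b, h, -⟩ := exists_of_mem_lattice l.2.1
    obtain ⟨a', b', h', e'⟩ := exists_of_mem_lattice l'.2.1
    obtain ⟨c, d, k, -⟩ := exists_of_mem_dualLattice l.2.2
    obtain ⟨c', d', k', f'⟩ := exists_of_mem_dualLattice l'.2.2
    rw [← Complex.exp_add, Complex.exp_eq_exp_iff_exists_int]
    refine ⟨b * c' + a' * d, ?_⟩
    simp only [AddSubgroup.coe_add, Prod.fst_add, Prod.snd_add, tauCoord_add, h, h']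
    have e1 : q.1 + (l' : ℂ × ℂ).1 = q.1 + (a' * δ + b' * τ) := by rw [e']
    have e2 : q.2 + (l' : ℂ × ℂ).2 = q.2 + (c' + tauCoord τ (l' : ℂ × ℂ).2 * τ) := by rw [← f']
    rw [e1, e2]
    push_cast
    rw [← k]; ring

/-- The flat line bundle on `M` of the Dolbeault class of `σ dz̄`, with constant multipliers
`e_l = exp(2πi σ l̄)`. -/
def dolbeaultBundle (δ : ℕ) (τ : ℍ) (σ : ℂ) : LineBundle (lattice δ τ) where
  mult l _ := Complex.exp (2 * π * Complex.I * σ * conj (l : ℂ))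
  holo l := differentiable_const _
  ne_zero l z := Complex.exp_ne_zero _
  compat l l' z := by rw [← Complex.exp_add]; simp [mul_add]

/-- The first defining property of the Poincaré bundle: its restriction to `M × {[μ̂]}` is the line
bundle with class `[μ̂] ∈ Pic⁰(M)`. -/
theorem poincare_restrictLeft (δ : ℕ) [NeZero δ] (τ : ℍ) (μ : ℂ) :
    ((poincare δ τ).restrictLeft μ).Iso (dolbeaultBundle δ τ (-Complex.I / (2 * τ.im) * μ)) := by
  have him : (τ.im : ℂ) ≠ 0 := by exact_mod_cast τ.im_ne_zero
  refine ⟨fun z => Complex.exp (2 * π * Complex.I * (-Complex.I / (2 * τ.im) * μ) * z),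
    by fun_prop, fun _ => Complex.exp_ne_zero _, fun l z => ?_⟩
  simp only [LineBundle.restrictLeft, poincare, dolbeaultBundle]
  rw [← Complex.exp_add, ← Complex.exp_add]
  congr 1
  have hc : conj (l : ℂ) = l - 2 * Complex.I * (l : ℂ).im := by
    apply Complex.ext <;> simp; ring
  rw [hc]
  simp only [tauCoord, Complex.zero_im, zero_div]
  push_cast
  field_simp
  linear_combination (-2 * μ * (l : ℂ).im) * Complex.I_sq

/-- The second defining property of the Poincaré bundle: its restriction to `{0} × M̂` is
holomorphically trivial. -/
theorem poincare_restrictRight (δ : ℕ) [NeZero δ] (τ : ℍ) :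
    ((poincare δ τ).restrictRight 0).Iso (LineBundle.trivial _) := by
  refine ⟨fun _ => 1, by fun_prop, fun _ => one_ne_zero, fun l z => ?_⟩
  simp [LineBundle.restrictRight, poincare, LineBundle.trivial, tauCoord]

/-- In the coordinates `μ` and `μ̂`, the linear lift of the map `φ : M → M̂` which sends `[μ]` to
`T_μ^* L₀ ⊗ L₀^*` is the identity (see `poincare_restrictLeft_phi`). -/
def phiLift : ℂ →L[ℂ] ℂ := ContinuousLinearMap.id ℂ ℂ

/-- The restriction of the Poincaré bundle to `M × {φ([μ])}` is `T_μ^* L₀ ⊗ L₀^*`. -/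
theorem poincare_restrictLeft_phi (δ : ℕ) [NeZero δ] (τ : ℍ) (μ : ℂ) :
    ((poincare δ τ).restrictLeft (phiLift μ)).Iso
      (((L₀ δ τ).translate μ).tensor (L₀ δ τ).dual) := by
  refine ⟨fun _ => 1, by fun_prop, fun _ => one_ne_zero, fun l z => ?_⟩
  simp only [LineBundle.restrictLeft, poincare, LineBundle.tensor, LineBundle.translate,
    LineBundle.dual, L₀, phiLift]
  rw [← Complex.exp_neg, ← Complex.exp_add, one_mul, mul_one]
  congr 1
  simp [tauCoord]; ring

lemma lattice_le_dualLattice (δ : ℕ) [NeZero δ] (τ : ℍ) : lattice δ τ ≤ dualLattice δ τ := by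
  have hd' : (δ : ℂ) ≠ 0 := NeZero.ne _
  intro l hl
  obtain ⟨a, b, rfl⟩ := AddSubgroup.mem_closure_pair.1 hl
  refine AddSubgroup.mem_closure_pair.2 ⟨a * δ, b * δ, ?_⟩
  simp; field_simp

lemma id_prodMap_phiLift_mem (δ : ℕ) [NeZero δ] (τ : ℍ) :
    ∀ l ∈ (lattice δ τ).prod (lattice δ τ), (ContinuousLinearMap.id ℂ ℂ).prodMap phiLift l ∈
      (lattice δ τ).prod (dualLattice δ τ) :=
  fun _ hl => ⟨hl.1, lattice_le_dualLattice δ τ hl.2⟩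

lemma fst_mem (δ : ℕ) (τ : ℍ) :
    ∀ l ∈ (lattice δ τ).prod (lattice δ τ), ContinuousLinearMap.fst ℂ ℂ ℂ l ∈ lattice δ τ :=
  fun _ hl => hl.1

/-- The pull-back `(Id × φ)^* P → M × M`. -/
def pullbackP (δ : ℕ) [NeZero δ] (τ : ℍ) : LineBundle ((lattice δ τ).prod (lattice δ τ)) :=
  (poincare δ τ).pullback ((ContinuousLinearMap.id ℂ ℂ).prodMap phiLift)
    (id_prodMap_phiLift_mem δ τ)

/-- The pull-back `π₁^* L₀ → M × M`. -/
def pullbackL₀ (δ : ℕ) (τ : ℍ) : LineBundle ((lattice δ τ).prod (lattice δ τ)) :=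
  (L₀ δ τ).pullback (ContinuousLinearMap.fst ℂ ℂ ℂ) (fst_mem δ τ)

/-- The line bundle `Ẽ' = π₁^* L₀ ⊗ (Id × φ)^* P → M × M`. -/
def Etilde' (δ : ℕ) [NeZero δ] (τ : ℍ) : LineBundle ((lattice δ τ).prod (lattice δ τ)) :=
  (pullbackL₀ δ τ).tensor (pullbackP δ τ)

/-! ### The Hermitian metrics -/

/-- The metric `h_{L₀}(z) = exp(-(2π/τ₂) z₂²)` on `L₀`. -/
def metricL₀ (δ : ℕ) (τ : ℍ) : HermitianMetric (L₀ δ τ) where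
  weight z := Real.exp (-2 * π / τ.im * z.im ^ 2)
  smooth := by
    have : ContDiff ℝ ∞ fun z : ℂ => z.im := Complex.imCLM.contDiff
    exact Real.contDiff_exp.comp (contDiff_const.mul (this.pow 2))
  pos z := Real.exp_pos _
  compat l z := by
    have := τ.im_ne_zero
    simp only [L₀]
    rw [Complex.norm_exp, ← Real.exp_nat_mul, ← Real.exp_add]
    congr 1
    have h2 : (((tauCoord τ (l : ℂ) : ℝ) : ℂ) ^ 2) = ((tauCoord τ (l : ℂ) ^ 2 : ℝ) : ℂ) := by simp
    rw [h2]
    simp [-Complex.ofReal_pow]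
    simp only [tauCoord]
    field_simp; ring

/-- The metric `h_{(Id × φ)^* P}(z, μ) = exp(-(4π/τ₂) z₂ μ₂)` on `(Id × φ)^* P`. -/
def metricP (δ : ℕ) [NeZero δ] (τ : ℍ) : HermitianMetric (pullbackP δ τ) where
  weight q := Real.exp (-4 * π / τ.im * q.1.im * q.2.im)
  smooth := by
    have h1 : ContDiff ℝ ∞ fun q : ℂ × ℂ => q.1.im := Complex.imCLM.contDiff.comp contDiff_fst
    have h2 : ContDiff ℝ ∞ fun q : ℂ × ℂ => q.2.im := Complex.imCLM.contDiff.comp contDiff_snd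
    exact Real.contDiff_exp.comp ((contDiff_const.mul h1).mul h2)
  pos q := Real.exp_pos _
  compat l q := by
    have := τ.im_ne_zero
    simp only [pullbackP, LineBundle.pullback, poincare]
    rw [Complex.norm_exp, ← Real.exp_nat_mul, ← Real.exp_add]
    congr 1
    simp [tauCoord, phiLift]
    field_simp; ring

/-- The metric `h_{Ẽ'} = π₁^* h_{L₀} ⊗ h_{(Id × φ)^* P}` on `Ẽ'`. -/
def metricEtilde' (δ : ℕ) [NeZero δ] (τ : ℍ) : HermitianMetric (Etilde' δ τ) :=
  ((metricL₀ δ τ).pullback (ContinuousLinearMap.fst ℂ ℂ ℂ) (fst_mem δ τ)).tensor (metricP δ τ)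

/-! ### The direct image `E' = (π₂)_* Ẽ'` and its `L²`-metric -/

/-- The preimage in `ℂ` of a subset `U` of the torus `M`. -/
def lift {δ : ℕ} {τ : ℍ} (U : Set (Torus δ τ)) : Set ℂ :=
  (fun μ : ℂ => (QuotientAddGroup.mk μ : Torus δ τ)) ⁻¹' U

/-- The fibre `E'_μ = H⁰(M, Ẽ'|_{M × {μ}})`. -/
def fibre (δ : ℕ) [NeZero δ] (τ : ℍ) (μ : ℂ) : Submodule ℂ (ℂ → ℂ) :=
  ((Etilde' δ τ).restrictLeft μ).globalSections

/-- A holomorphic section of `E' = (π₂)_* Ẽ'` over `U ⊆ M` is a holomorphic section of `Ẽ'` over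
`π₂⁻¹(U) = M × U`. -/
def IsSection {δ : ℕ} [NeZero δ] {τ : ℍ} (U : Set (Torus δ τ)) (s : ℂ × ℂ → ℂ) : Prop :=
  (Etilde' δ τ).IsSectionOn (Set.univ ×ˢ lift U) s

/-- A holomorphic frame of `E'` over `U`: holomorphic sections whose restrictions to `M × {μ}` form a
basis of the fibre `E'_μ`, for all `[μ] ∈ U`. -/
structure IsFrame {δ : ℕ} [NeZero δ] {τ : ℍ} (U : Set (Torus δ τ)) {n : ℕ}
    (s : Fin n → ℂ × ℂ → ℂ) : Prop where
  isSection : ∀ i, IsSection U (s i)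
  linearIndependent : ∀ μ ∈ lift U, LinearIndependent ℂ fun i z => s i (z, μ)
  span_eq : ∀ μ ∈ lift U, Submodule.span ℂ (Set.range fun i z => s i (z, μ)) = fibre δ τ μ

/-- The fundamental parallelogram of `Λ`. -/
def parallelogram (δ : ℕ) (τ : ℍ) : Set ℂ :=
  {z | ∃ x ∈ Set.Ico (0 : ℝ) 1, ∃ y ∈ Set.Ico (0 : ℝ) 1, z = x * δ + y * τ}

/-- The `L²` inner product `∫_M h_{Ẽ'}(z, μ) f(z) \overline{g(z)} (i/2) dz ∧ dz̄` on `E'_μ`;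
`(i/2) dz ∧ dz̄` is Lebesgue measure. -/
def l2Inner (δ : ℕ) [NeZero δ] (τ : ℍ) (μ : ℂ) (f g : ℂ → ℂ) : ℂ :=
  ∫ z in parallelogram δ τ, ((metricEtilde' δ τ).weight (z, μ) : ℂ) * f z * conj (g z)

/-- The Gram matrix `H_ij = (s_i, s_j)` for the `L²`-metric `h_{E'}`. -/
def gram (δ : ℕ) [NeZero δ] (τ : ℍ) {n : ℕ} (s : Fin n → ℂ × ℂ → ℂ) (μ : ℂ) :
    Matrix (Fin n) (Fin n) ℂ :=
  Matrix.of fun i j => l2Inner δ τ μ (fun z => s i (z, μ)) fun z => s j (z, μ)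

end ThetaTorus

end

noncomputable section

namespace ThetaTorus

/-! ### Global sections of `L₀` -/

/-! The restriction of `Etilde'` to `M × {μ}` has exactly the multipliers of `L₀` translated by `μ`,
so `w = z + μ` identifies every fibre `E'_μ` with the fixed space `H⁰(M, L₀)` (`mem_fibre_iff`).
Under this identification a shift of `μ` by a lattice vector acts through the inverse multiplier of
`L₀`; in other words `E' ≅ H⁰(M, L₀) ⊗ L₀^*`, and local frames are a basis of theta functions times
a nowhere zero local section of `L₀^*` (`isFrame_thetaFrame`).

The metric respects this splitting. Completing the square in the exponent gives `h(z, μ) = φ(μ)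
h_{L₀}(z + μ)` with `φ = 1 / h_{L₀}` (`weight_metricEtilde'`). As integrals over `M` are translation
invariant, the Gram matrix of any holomorphic frame is `H = φ A G A^*`: `G` is the constant Gram
matrix of the theta functions, and `A` is the holomorphic matrix expressing the frame through them
(`IsFrame.gram_eq`). A constant metric in a holomorphically varying basis is flat, so all curvature
comes from the scalar `φ`, the dual of the metric of `L₀`; this explains both the sign and the
identity matrix (`chernCurvature_twisted`).

The rank is `dim H⁰(M, L₀) = δ`. Translation by `1` separates the `δ` theta functions, which gives
independence. Quasi-periodicity in `τ` determines all Fourier coefficients of a section from `δ` of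
them, which gives the upper bound (`exists_eq_sum_thetaChar`). -/

lemma lattice_left_mem (δ : ℕ) (τ : ℍ) : (δ : ℂ) ∈ lattice δ τ :=
  AddSubgroup.subset_closure (by simp)

lemma lattice_right_mem (δ : ℕ) (τ : ℍ) : (τ : ℂ) ∈ lattice δ τ :=
  AddSubgroup.subset_closure (by simp)

lemma tauCoord_natCast (τ : ℍ) (n : ℕ) : tauCoord τ n = 0 := by
  simp [tauCoord]

lemma tauCoord_self (τ : ℍ) : tauCoord τ τ = 1 := by
  have := τ.im_ne_zero
  simp [tauCoord, this]

lemma LineBundle.mult_zero {W : Type*} [NormedAddCommGroup W] [NormedSpace ℂ W]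
    {Γ : AddSubgroup W} (L : LineBundle Γ) (v : W) : L.mult 0 v = 1 := by
  have h := L.compat 0 0 v
  simp only [add_zero, ZeroMemClass.coe_zero] at h
  exact mul_left_cancel₀ (L.ne_zero 0 v) (by rw [← h, mul_one])

/-- Quasi-periodicity needs to be checked on generators of the lattice only. -/
lemma LineBundle.quasiperiodic_of_closure {W : Type*} [NormedAddCommGroup W] [NormedSpace ℂ W]
    {S : Set W} (L : LineBundle (AddSubgroup.closure S)) {f : W → ℂ}
    (h : ∀ (l : W) (hl : l ∈ S) v,
      f (v + l) = L.mult ⟨l, AddSubgroup.subset_closure hl⟩ v * f v)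
    (l : AddSubgroup.closure S) (v : W) : f (v + (l : W)) = L.mult l v * f v := by
  obtain ⟨l, hl⟩ := l
  induction hl using AddSubgroup.closure_induction generalizing v with
  | mem x hx => exact h x hx v
  | zero =>
    have := L.mult_zero v
    simp only [add_zero]
    rw [show (⟨0, _⟩ : AddSubgroup.closure S) = 0 from rfl, this, one_mul]
  | add x y hx hy ihx ihy =>
    have := L.compat ⟨x, hx⟩ ⟨y, hy⟩ v
    rw [show (⟨x + y, _⟩ : AddSubgroup.closure S) = ⟨x, hx⟩ + ⟨y, hy⟩ from rfl, this]
    change f (v + (x + y)) = L.mult ⟨x, hx⟩ (v + y) * L.mult ⟨y, hy⟩ v * f v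
    simp only at ihx ihy
    rw [show v + (x + y) = v + y + x by abel, ihx, ihy, mul_assoc]
  | neg x hx ih =>
    have h1 := L.compat ⟨x, hx⟩ (-⟨x, hx⟩) v
    rw [add_neg_cancel, L.mult_zero] at h1
    have h2 := ih (v + -x)
    simp only [neg_add_cancel_right] at h2
    simp only [NegMemClass.coe_neg] at h1
    rw [show (⟨-x, _⟩ : AddSubgroup.closure S) = -⟨x, hx⟩ from rfl]
    change f (v + -x) = _
    rw [h2, ← mul_assoc, mul_comm (L.mult _ _), ← h1, one_mul]

lemma mem_globalSections_L₀ {δ : ℕ} {τ : ℍ} {f : ℂ → ℂ} :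
    f ∈ (L₀ δ τ).globalSections ↔ Differentiable ℂ f ∧ (∀ z, f (z + δ) = f z) ∧
      ∀ z, f (z + τ) = Complex.exp (-2 * π * Complex.I * z - π * Complex.I * τ) * f z := by
  constructor
  · rintro ⟨h1, h2⟩
    refine ⟨differentiableOn_univ.1 h1, fun z => ?_, fun z => ?_⟩
    · rw [h2 ⟨δ, lattice_left_mem δ τ⟩ z trivial]
      simp [L₀, tauCoord_natCast]
    · rw [h2 ⟨τ, lattice_right_mem δ τ⟩ z trivial]
      simp [L₀, tauCoord_self]
  · rintro ⟨h1, h2, h3⟩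
    refine ⟨h1.differentiableOn, fun l v _ => ?_⟩
    refine LineBundle.quasiperiodic_of_closure (L₀ δ τ) (fun l hl v => ?_) l v
    rcases hl with rfl | rfl
    · simp [L₀, tauCoord_natCast, h2]
    · simp [L₀, tauCoord_self, h3]

/-- The theta functions `e^{2πi m w / δ} ϑ(w + m τ / δ, τ)`. -/
def thetaChar (δ : ℕ) (τ : ℍ) (m : ℕ) (w : ℂ) : ℂ :=
  Complex.exp (2 * π * Complex.I * m * w / δ) * jacobiTheta₂ (w + m * τ / δ) τ

lemma differentiable_thetaChar (δ : ℕ) (τ : ℍ) (m : ℕ) : Differentiable ℂ (thetaChar δ τ m) := by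
  have h : Differentiable ℂ fun w => jacobiTheta₂ w (τ : ℂ) := fun w =>
    differentiableAt_jacobiTheta₂_fst w τ.im_pos
  have h2 : Differentiable ℂ fun w => jacobiTheta₂ (w + m * τ / δ) (τ : ℂ) :=
    h.comp (differentiable_id.add_const _)
  exact Differentiable.mul (by fun_prop) h2

lemma jacobiTheta₂_add_natCast (z τ : ℂ) (n : ℕ) : jacobiTheta₂ (z + n) τ = jacobiTheta₂ z τ := by
  induction n with
  | zero => simp
  | succ n ih => rw [Nat.cast_succ, ← add_assoc, jacobiTheta₂_add_left, ih]

/-- Theta functions are eigenvectors of translation by `1`, with eigenvalue `e^{2πi m / δ}`. For `m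
< δ` these eigenvalues are distinct, and the coordinate functionals below rely on this. -/
lemma thetaChar_add_natCast (δ : ℕ) (τ : ℍ) (m j : ℕ) (w : ℂ) :
    thetaChar δ τ m (w + j) = Complex.exp (2 * π * Complex.I * m * j / δ) * thetaChar δ τ m w := by
  rw [thetaChar, thetaChar, add_right_comm, jacobiTheta₂_add_natCast, ← mul_assoc,
    ← Complex.exp_add]
  congr 2; ring

lemma thetaChar_mem (δ : ℕ) [NeZero δ] (τ : ℍ) (m : ℕ) :
    thetaChar δ τ m ∈ (L₀ δ τ).globalSections := by
  have hd : (δ : ℂ) ≠ 0 := NeZero.ne _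
  refine mem_globalSections_L₀.2 ⟨differentiable_thetaChar δ τ m, fun z => ?_, fun z => ?_⟩
  · rw [thetaChar_add_natCast]
    have : Complex.exp (2 * π * Complex.I * m * δ / δ) = 1 :=
      Complex.exp_eq_one_iff.2 ⟨m, by push_cast; field_simp⟩
    rw [this, one_mul]
  · rw [thetaChar, thetaChar, add_right_comm, jacobiTheta₂_add_left', ← mul_assoc, ← mul_assoc,
      ← Complex.exp_add, ← Complex.exp_add]
    congr 2; field_simp; ring

/-- The constant Fourier coefficient of the Jacobi theta function is `1`. -/
lemma integral_jacobiTheta₂ (τ : ℍ) : ∫ x in (0 : ℝ)..1, jacobiTheta₂ x τ = 1 := by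
  let F : ℤ → C(ℝ, ℂ) := fun n => ⟨fun x => jacobiTheta₂_term n x τ, by
    unfold jacobiTheta₂_term; fun_prop⟩
  have hn : ∀ n (x : ℝ), ‖F n x‖ = ‖jacobiTheta₂_term n 0 τ‖ := fun n x => by
    simp only [F, ContinuousMap.coe_mk, norm_jacobiTheta₂_term]; simp
  have hs : Summable fun n : ℤ => ‖jacobiTheta₂_term n 0 τ‖ :=
    ((summable_jacobiTheta₂_term_iff 0 τ).2 τ.im_pos).norm
  have h := intervalIntegral.tsum_intervalIntegral_eq_of_summable_norm (a := 0) (b := 1) (f := F)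
    (Summable.of_nonneg_of_le (fun _ => norm_nonneg _) (fun n => by
      refine (ContinuousMap.norm_le _ (norm_nonneg _)).2 fun x => ?_
      exact (hn n x).le) hs)
  -- The series may be integrated termwise since term norms do not depend on real `x`; only the `n =
  -- 0` term has a nonzero mean.
  have h0 : ∀ n, ∫ x in (0 : ℝ)..1, F n x = if n = 0 then 1 else 0 := by
    intro n
    split_ifs with h0
    · subst h0; simp [F, jacobiTheta₂_term]
    · have hc : (2 * π * Complex.I * n : ℂ) ≠ 0 := by
        simp [h0, Real.pi_ne_zero]
      have : ∀ x : ℝ, F n x = Complex.exp (π * Complex.I * n ^ 2 * τ) *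
          Complex.exp ((2 * π * Complex.I * n) * x) := fun x => by
        simp only [F, ContinuousMap.coe_mk, jacobiTheta₂_term]
        rw [← Complex.exp_add]; congr 1; ring
      simp_rw [this]
      rw [intervalIntegral.integral_const_mul, integral_exp_mul_complex hc]
      have h1 : Complex.exp (2 * π * Complex.I * n * (1 : ℝ)) = 1 :=
        Complex.exp_eq_one_iff.2 ⟨n, by push_cast; ring⟩
      rw [h1]; simp
  simp only [h0, tsum_ite_eq] at h
  exact h.symm

/-- Otherwise the Jacobi theta function would vanish identically, against its mean value `1` over a
period. -/
lemma exists_thetaChar_ne_zero (δ : ℕ) (τ : ℍ) (m : ℕ) : ∃ w, thetaChar δ τ m w ≠ 0 := by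
  by_contra! h
  have h1 : ∀ w, jacobiTheta₂ w τ = 0 := fun w => by
    have := h (w - m * τ / δ)
    simpa [thetaChar, Complex.exp_ne_zero] using this
  have := integral_jacobiTheta₂ τ
  simp [h1] at this

/-- Orthogonality of the characters of `ℤ / δ`. -/
lemma sum_exp_mul_exp (δ : ℕ) [NeZero δ] (m n : Fin δ) :
    ∑ j ∈ Finset.range δ, Complex.exp (-(2 * π * Complex.I * (m : ℕ) * j / δ)) *
      Complex.exp (2 * π * Complex.I * (n : ℕ) * j / δ) = if m = n then (δ : ℂ) else 0 := by
  have hd : (δ : ℂ) ≠ 0 := NeZero.ne _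
  split_ifs with h
  · subst h; simp [← Complex.exp_add]
  · set r := Complex.exp (2 * π * Complex.I * ((n : ℕ) - (m : ℕ)) / δ) with hr
    have hpow : ∀ j : ℕ, Complex.exp (-(2 * π * Complex.I * (m : ℕ) * j / δ)) *
        Complex.exp (2 * π * Complex.I * (n : ℕ) * j / δ) = r ^ j := fun j => by
      rw [hr, ← Complex.exp_nat_mul, ← Complex.exp_add]; congr 1; ring
    simp_rw [hpow]
    have h1 : r ≠ 1 := by
      intro h1
      obtain ⟨k, hk⟩ := Complex.exp_eq_one_iff.1 h1
      have h2 : ((n : ℕ) : ℂ) - (m : ℕ) = k * δ := by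
        have := Complex.two_pi_I_ne_zero
        field_simp at hk
        linear_combination hk
      have h3 : ((n : ℕ) : ℤ) - (m : ℕ) = k * δ := by exact_mod_cast h2
      -- Indices lie in `[0, δ)`, so a difference divisible by `δ` must be zero.
      have h4 : (((n : ℕ) : ℤ) - (m : ℕ)).natAbs < δ := by
        have := m.2; have := n.2; omega
      have h5 := Int.eq_zero_of_dvd_of_natAbs_lt_natAbs (Dvd.intro_left k h3.symm)
        (by simpa using h4)
      apply h; ext; omega
    rw [geom_sum_eq h1, ← hpow]
    have h2 : Complex.exp (-(2 * π * Complex.I * (m : ℕ) * δ / δ)) *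
        Complex.exp (2 * π * Complex.I * (n : ℕ) * δ / δ) = 1 := by
      rw [← Complex.exp_add]
      exact Complex.exp_eq_one_iff.2 ⟨n - m, by push_cast; field_simp; ring⟩
    rw [h2]; simp

/-- A point at which the `m`-th theta function does not vanish. -/
def thetaPoint (δ : ℕ) (τ : ℍ) (m : ℕ) : ℂ := (exists_thetaChar_ne_zero δ τ m).choose

/-- The `m`-th coordinate of a section of `L₀` in the basis of theta functions. -/
def thetaCoord (δ : ℕ) (τ : ℍ) (m : ℕ) : (ℂ → ℂ) →ₗ[ℂ] ℂ where
  -- Averaging over translations by `j < δ` against the inverse character projects onto the `m`-th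
  -- eigenspace; the prefactor normalises by the value at `thetaPoint`. Only finitely many point
  -- evaluations occur, so holomorphic dependence on a parameter is preserved.
  toFun f := (δ * thetaChar δ τ m (thetaPoint δ τ m))⁻¹ * ∑ j ∈ Finset.range δ,
    Complex.exp (-(2 * π * Complex.I * m * j / δ)) * f (thetaPoint δ τ m + j)
  map_add' f g := by simp only [Pi.add_apply, mul_add, Finset.sum_add_distrib]
  map_smul' c f := by
    simp only [Pi.smul_apply, smul_eq_mul, RingHom.id_apply, Finset.mul_sum]
    exact Finset.sum_congr rfl fun _ _ => by ring

lemma thetaCoord_thetaChar (δ : ℕ) [NeZero δ] (τ : ℍ) (m n : Fin δ) :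
    thetaCoord δ τ m (thetaChar δ τ n) = if m = n then 1 else 0 := by
  have hd : (δ : ℂ) ≠ 0 := NeZero.ne _
  have h0 : thetaChar δ τ m (thetaPoint δ τ m) ≠ 0 := (exists_thetaChar_ne_zero δ τ m).choose_spec
  simp only [thetaCoord, LinearMap.coe_mk, AddHom.coe_mk, thetaChar_add_natCast]
  simp_rw [← mul_assoc]
  rw [← Finset.sum_mul, sum_exp_mul_exp]
  split_ifs with h
  · subst h; field_simp
  · simp

lemma linearIndependent_thetaChar (δ : ℕ) [NeZero δ] (τ : ℍ) :
    LinearIndependent ℂ fun m : Fin δ => thetaChar δ τ m := by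
  rw [Fintype.linearIndependent_iff]
  intro g hg m
  have := congrArg (thetaCoord δ τ m) hg
  simpa [map_sum, thetaCoord_thetaChar] using this

/-! ### The dimension of the space of sections, by Fourier expansion -/

/-- Zero coefficients are summable, so the Fourier series converges pointwise to the continuous
function `f`. -/
lemma eq_zero_of_fourierCoeff_eq_zero {T : ℝ} (hT : 0 < T) {f : ℝ → ℂ} (hf : Continuous f)
    (hp : Function.Periodic f T)
    (h : ∀ k : ℤ, ∫ x in (0 : ℝ)..T, f x * Complex.exp (-(2 * π * Complex.I * k * x / T)) = 0)
    (x : ℝ) : f x = 0 := by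
  have : Fact (0 < T) := ⟨hT⟩
  let F : C(AddCircle T, ℂ) := ⟨hp.lift, by
    exact continuous_quot_lift _ hf⟩
  have hF : ∀ y : ℝ, F (y : AddCircle T) = f y := fun y => hp.lift_coe y
  have hc : fourierCoeff F = 0 := by
    funext k
    rw [fourierCoeff_eq_intervalIntegral (F : AddCircle T → ℂ) k 0, zero_add]
    have : ∀ y : ℝ, fourier (-k) (y : AddCircle T) • F (y : AddCircle T) =
        f y * Complex.exp (-(2 * π * Complex.I * k * y / T)) := fun y => by
      rw [fourier_coe_apply, hF, smul_eq_mul, mul_comm]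
      congr 2; push_cast; ring
    simp only [this, h k, smul_zero, Pi.zero_apply]
  have hs := has_pointwise_sum_fourier_series_of_summable (f := F)
    (by rw [hc]; exact summable_zero) (x : AddCircle T)
  simp only [hc, Pi.zero_apply, zero_smul, hF] at hs
  exact hs.unique hasSum_zero

/-- The integral of a periodic entire function over a period does not depend on the line. -/
lemma intervalIntegral_add_of_periodic {T : ℝ} {g : ℂ → ℂ} (hg : Differentiable ℂ g)
    (hp : ∀ z, g (z + T) = g z) (τ : ℂ) :
    ∫ x in (0 : ℝ)..T, g (x + τ) = ∫ x in (0 : ℝ)..T, g x := by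
  -- Cauchy's theorem on a rectangle of width `T` and height `τ.im`: the vertical sides cancel by
  -- periodicity. The remaining horizontal shift by `τ.re` is absorbed by periodicity on the real
  -- line.
  have h := Complex.integral_boundary_rect_eq_zero_of_differentiableOn g 0 (T + τ.im * Complex.I)
    hg.differentiableOn
  have h1 : ∀ y : ℝ, g (T + y * Complex.I) = g (y * Complex.I) := fun y => by
    rw [add_comm, hp]
  simp [h1] at h
  rw [sub_eq_zero.1 h]
  have hper : Function.Periodic (fun x : ℝ => g (x + τ.im * Complex.I)) T := fun x => by
    simp only
    push_cast
    rw [add_right_comm, hp]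
  have h2 := hper.intervalIntegral_add_eq τ.re 0
  rw [zero_add] at h2
  have h3 := intervalIntegral.integral_comp_add_right (a := 0) (b := T)
    (fun x : ℝ => g (x + τ.im * Complex.I)) τ.re
  rw [zero_add, add_comm T] at h3
  rw [← h2, ← h3]
  congr 1; funext x
  congr 1
  nth_rw 1 [← Complex.re_add_im τ]
  push_cast; ring

/-- The Fourier coefficients of a function of period `δ`. -/
def fourierIntegral (δ : ℕ) (k : ℤ) (f : ℂ → ℂ) : ℂ :=
  ∫ x in (0 : ℝ)..δ, f x * Complex.exp (-(2 * π * Complex.I * k * x / δ))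

/-- Moving the line of integration by `τ` brings in the multiplier `e^{-2πi x - πi τ}`, whose factor
`e^{-2πi x}` raises the frequency by `δ`, because frequencies are measured in units of `1 / δ`. -/
lemma fourierIntegral_recurrence {δ : ℕ} [NeZero δ] {τ : ℍ} {f : ℂ → ℂ}
    (hf : f ∈ (L₀ δ τ).globalSections) (k : ℤ) :
    fourierIntegral δ k f = Complex.exp (-(π * Complex.I * τ + 2 * π * Complex.I * k * τ / δ)) *
      fourierIntegral δ (k + δ) f := by
  have hd : (δ : ℂ) ≠ 0 := NeZero.ne _
  obtain ⟨h1, h2, h3⟩ := mem_globalSections_L₀.1 hf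
  have h := intervalIntegral_add_of_periodic (T := δ)
    (g := fun z => f z * Complex.exp (-(2 * π * Complex.I * k * z / δ)))
    (h1.mul (by fun_prop)) (fun z => by
      simp only [Complex.ofReal_natCast]
      rw [h2]
      congr 1
      rw [Complex.exp_eq_exp_iff_exists_int]
      exact ⟨-k, by push_cast; field_simp; ring⟩) τ
  rw [fourierIntegral, ← h, fourierIntegral, ← intervalIntegral.integral_const_mul]
  congr 1; funext x
  rw [h3, mul_right_comm, ← Complex.exp_add, mul_left_comm, ← Complex.exp_add, mul_comm]
  congr 2
  push_cast; field_simp; ring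

/-- The recurrence has nonzero factors and step `δ`, so one coefficient in each residue class modulo
`δ` controls the whole class. With all coefficients zero, `f` vanishes on the real line, hence
everywhere by the identity theorem. -/
lemma eq_zero_of_fourierIntegral_eq_zero {δ : ℕ} [NeZero δ] {τ : ℍ} {f : ℂ → ℂ}
    (hf : f ∈ (L₀ δ τ).globalSections) (h : ∀ m : Fin δ, fourierIntegral δ (m : ℕ) f = 0) :
    f = 0 := by
  obtain ⟨h1, h2, h3⟩ := mem_globalSections_L₀.1 hf
  have hd : 0 < δ := Nat.pos_of_neZero δ
  have hstep : ∀ (m : Fin δ) (q : ℤ), fourierIntegral δ ((m : ℕ) + q * δ) f = 0 := by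
    intro m q
    induction q using Int.induction_on with
    | zero => simpa using h m
    | succ q ih =>
      rw [fourierIntegral_recurrence hf] at ih
      have := (mul_eq_zero.1 ih).resolve_left (Complex.exp_ne_zero _)
      rwa [show ((m : ℕ) : ℤ) + (q + 1) * δ = (m : ℕ) + q * δ + δ by ring]
    | pred q ih =>
      rw [fourierIntegral_recurrence hf,
        show ((m : ℕ) : ℤ) + (-q - 1) * δ + δ = (m : ℕ) + -q * δ by ring, ih, mul_zero]
  have hall : ∀ k, fourierIntegral δ k f = 0 := by
    intro k
    have hd' : (0 : ℤ) < δ := by exact_mod_cast hd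
    have h4 := Int.emod_nonneg k hd'.ne'
    have h5 := Int.emod_lt_of_pos k hd'
    have := hstep ⟨(k % δ).toNat, by omega⟩ (k / δ)
    simp only [Int.toNat_of_nonneg h4] at this
    rwa [mul_comm, Int.emod_add_mul_ediv] at this
  have hreal : ∀ x : ℝ, f x = 0 := by
    refine eq_zero_of_fourierCoeff_eq_zero (T := δ) (by exact_mod_cast hd)
      (h1.continuous.comp Complex.continuous_ofReal) (fun x => ?_) (fun k => ?_)
    · simpa using h2 x
    · simpa [fourierIntegral] using hall k
  refine AnalyticOnNhd.eq_of_frequently_eq (z₀ := 0)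
    (h1.differentiableOn.analyticOnNhd isOpen_univ) (fun _ _ => analyticAt_const) ?_
  have ht : Filter.Tendsto (fun x : ℝ => (x : ℂ)) (nhdsWithin 0 {0}ᶜ) (nhdsWithin 0 {0}ᶜ) := by
    refine tendsto_nhdsWithin_iff.2 ⟨?_, ?_⟩
    · exact (Complex.continuous_ofReal.tendsto' 0 0 (by simp)).mono_left nhdsWithin_le_nhds
    · filter_upwards [self_mem_nhdsWithin] with x hx
      simpa using hx
  exact ht.frequently (Filter.Eventually.frequently (Filter.Eventually.of_forall hreal))

/-- The theta functions span the space of sections of `L₀`. -/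
lemma exists_eq_sum_thetaChar {δ : ℕ} [NeZero δ] {τ : ℍ} {f : ℂ → ℂ}
    (hf : f ∈ (L₀ δ τ).globalSections) :
    ∃ c : Fin δ → ℂ, f = ∑ m : Fin δ, c m • thetaChar δ τ m := by
  -- Injectivity of these `δ` Fourier coefficients bounds the dimension by `δ`; the independent
  -- theta functions then form a basis.
  let Φ : (L₀ δ τ).globalSections →ₗ[ℂ] Fin δ → ℂ :=
    { toFun := fun f m => fourierIntegral δ (m : ℕ) f
      map_add' := fun f g => by
        funext m
        have hc : ∀ f : (L₀ δ τ).globalSections, IntervalIntegrable (fun x : ℝ => (f : ℂ → ℂ) x *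
            Complex.exp (-(2 * π * Complex.I * ((m : ℕ) : ℤ) * x / δ))) MeasureTheory.volume 0 δ := by
          intro f
          have : Continuous (f : ℂ → ℂ) := (mem_globalSections_L₀.1 f.2).1.continuous
          apply Continuous.intervalIntegrable
          fun_prop
        simp only [fourierIntegral, Pi.add_apply, Submodule.coe_add, add_mul]
        exact intervalIntegral.integral_add (hc f) (hc g)
      map_smul' := fun c f => by
        funext m
        simp only [fourierIntegral, Pi.smul_apply, Submodule.coe_smul, smul_eq_mul, mul_assoc,
          RingHom.id_apply]
        exact intervalIntegral.integral_const_mul _ _ }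
  have hinj : Function.Injective Φ := by
    rw [← LinearMap.ker_eq_bot, LinearMap.ker_eq_bot']
    intro f h
    exact Subtype.ext (eq_zero_of_fourierIntegral_eq_zero f.2 fun m => congrFun h m)
  let b : Fin δ → (L₀ δ τ).globalSections := fun m => ⟨thetaChar δ τ m, thetaChar_mem δ τ m⟩
  have hb : LinearIndependent ℂ b :=
    LinearIndependent.of_comp (L₀ δ τ).globalSections.subtype (linearIndependent_thetaChar δ τ)
  have : FiniteDimensional ℂ (L₀ δ τ).globalSections := Module.Finite.of_injective Φ hinj
  have hle := LinearMap.finrank_le_finrank_of_injective hinj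
  have hge := hb.fintype_card_le_finrank
  have hspan := hb.span_eq_top_of_card_eq_finrank (le_antisymm hge (by simpa using hle))
  have hmem : (⟨f, hf⟩ : (L₀ δ τ).globalSections) ∈ Submodule.span ℂ (Set.range b) := by
    rw [hspan]; trivial
  obtain ⟨c, hc⟩ := (Submodule.mem_span_range_iff_exists_fun ℂ).1 hmem
  refine ⟨c, ?_⟩
  have := congrArg Subtype.val hc
  simpa [b] using this.symm

lemma eq_sum_thetaCoord {δ : ℕ} [NeZero δ] {τ : ℍ} {f : ℂ → ℂ}
    (hf : f ∈ (L₀ δ τ).globalSections) (w : ℂ) :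
    f w = ∑ m : Fin δ, thetaCoord δ τ m f * thetaChar δ τ m w := by
  obtain ⟨c, rfl⟩ := exists_eq_sum_thetaChar hf
  simp [map_sum, thetaCoord_thetaChar, Finset.sum_apply]

/-! ### Integration over the fundamental parallelogram -/

/-- The coefficient of `δ` of a complex number in the real basis `(δ, τ)`. -/
def deltaCoord (δ : ℕ) (τ : ℍ) (z : ℂ) : ℝ := (z.re - tauCoord τ z * τ.re) / δ

lemma eq_deltaCoord_add_tauCoord (δ : ℕ) [NeZero δ] (τ : ℍ) (z : ℂ) :
    z = deltaCoord δ τ z * δ + tauCoord τ z * τ := by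
  have hd : (δ : ℝ) ≠ 0 := NeZero.ne _
  have := τ.im_ne_zero
  apply Complex.ext
  · simp [deltaCoord]
  · simp [tauCoord, this]

lemma tauCoord_real_add (δ : ℕ) (τ : ℍ) (x y : ℝ) : tauCoord τ (x * δ + y * τ) = y := by
  have := τ.im_ne_zero
  simp [tauCoord, this]

lemma deltaCoord_real_add (δ : ℕ) [NeZero δ] (τ : ℍ) (x y : ℝ) :
    deltaCoord δ τ (x * δ + y * τ) = x := by
  have hd : (δ : ℝ) ≠ 0 := NeZero.ne _
  rw [deltaCoord, tauCoord_real_add]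
  simp [hd]

lemma mem_parallelogram {δ : ℕ} [NeZero δ] {τ : ℍ} {z : ℂ} : z ∈ parallelogram δ τ ↔
    deltaCoord δ τ z ∈ Set.Ico (0 : ℝ) 1 ∧ tauCoord τ z ∈ Set.Ico (0 : ℝ) 1 := by
  constructor
  · rintro ⟨x, hx, y, hy, rfl⟩
    rw [deltaCoord_real_add, tauCoord_real_add]
    exact ⟨hx, hy⟩
  · rintro ⟨hx, hy⟩
    exact ⟨_, hx, _, hy, eq_deltaCoord_add_tauCoord δ τ z⟩

lemma continuous_tauCoord (τ : ℍ) : Continuous (tauCoord τ) :=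
  Complex.continuous_im.div_const _

lemma continuous_deltaCoord (δ : ℕ) (τ : ℍ) : Continuous (deltaCoord δ τ) :=
  (Complex.continuous_re.sub ((continuous_tauCoord τ).mul_const _)).div_const _

lemma measurableSet_parallelogram (δ : ℕ) [NeZero δ] (τ : ℍ) :
    MeasurableSet (parallelogram δ τ) := by
  have : parallelogram δ τ = deltaCoord δ τ ⁻¹' Set.Ico 0 1 ∩ tauCoord τ ⁻¹' Set.Ico 0 1 := by
    ext z; exact mem_parallelogram
  rw [this]
  exact ((continuous_deltaCoord δ τ).measurable measurableSet_Ico).inter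
    ((continuous_tauCoord τ).measurable measurableSet_Ico)

lemma existsUnique_int_add_mem_Ico (x : ℝ) : ∃! n : ℤ, (n : ℝ) + x ∈ Set.Ico (0 : ℝ) 1 := by
  refine ⟨-⌊x⌋, ?_, fun n hn => ?_⟩
  · have h1 := Int.floor_le x
    have h2 := Int.lt_floor_add_one x
    constructor <;> push_cast <;> linarith
  · have : ⌊x⌋ = -n := by
      rw [Int.floor_eq_iff]
      push_cast
      exact ⟨by linarith [hn.1], by linarith [hn.2]⟩
    rw [this, neg_neg]

lemma existsUnique_add_mem_parallelogram (δ : ℕ) [NeZero δ] (τ : ℍ) (z : ℂ) :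
    ∃! l : lattice δ τ, (l : ℂ) + z ∈ parallelogram δ τ := by
  obtain ⟨a, ha, ha'⟩ := existsUnique_int_add_mem_Ico (deltaCoord δ τ z)
  obtain ⟨b, hb, hb'⟩ := existsUnique_int_add_mem_Ico (tauCoord τ z)
  have key : ∀ a b : ℤ, ((a * δ + b * τ : ℂ) + z ∈ parallelogram δ τ ↔
      (a : ℝ) + deltaCoord δ τ z ∈ Set.Ico (0 : ℝ) 1 ∧
        (b : ℝ) + tauCoord τ z ∈ Set.Ico (0 : ℝ) 1) := by
    intro a b
    have : (a * δ + b * τ : ℂ) + z =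
        ((a + deltaCoord δ τ z : ℝ) : ℂ) * δ + ((b + tauCoord τ z : ℝ) : ℂ) * τ := by
      conv_lhs => rw [eq_deltaCoord_add_tauCoord δ τ z]
      push_cast; ring
    rw [this, mem_parallelogram, deltaCoord_real_add, tauCoord_real_add]
  refine ⟨⟨a * δ + b * τ, AddSubgroup.mem_closure_pair.2 ⟨a, b, by simp⟩⟩,
    (key a b).2 ⟨ha, hb⟩, ?_⟩
  rintro ⟨l, hl⟩ h
  obtain ⟨a', b', -, rfl⟩ := exists_of_mem_lattice hl
  obtain ⟨h1, h2⟩ := (key a' b').1 h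
  obtain rfl := ha' a' h1
  obtain rfl := hb' b' h2
  rfl

instance countable_lattice (δ : ℕ) (τ : ℍ) : Countable (lattice δ τ) := by
  have : Function.Surjective fun p : ℤ × ℤ =>
      (⟨p.1 • (δ : ℂ) + p.2 • (τ : ℂ), AddSubgroup.mem_closure_pair.2 ⟨p.1, p.2, rfl⟩⟩ :
        lattice δ τ) := by
    rintro ⟨l, hl⟩
    obtain ⟨a, b, h⟩ := AddSubgroup.mem_closure_pair.1 hl
    exact ⟨(a, b), Subtype.ext h⟩
  exact this.countable

open MeasureTheory in
lemma isAddFundamentalDomain_parallelogram_add (δ : ℕ) [NeZero δ] (τ : ℍ) (c : ℂ) :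
    IsAddFundamentalDomain (lattice δ τ) ((fun z => z + c) ⁻¹' parallelogram δ τ) volume := by
  refine IsAddFundamentalDomain.mk'
    ((measurable_add_const c) (measurableSet_parallelogram δ τ)).nullMeasurableSet fun z => ?_
  have := existsUnique_add_mem_parallelogram δ τ (z + c)
  simpa only [Set.mem_preimage, AddSubgroup.vadd_def, vadd_eq_add, add_assoc] using this

open MeasureTheory in
/-- Integrals of doubly periodic functions over the fundamental parallelogram are translation
invariant. -/
lemma setIntegral_parallelogram_add (δ : ℕ) [NeZero δ] (τ : ℍ) {Φ : ℂ → ℂ}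
    (hΦ : ∀ l ∈ lattice δ τ, ∀ z, Φ (z + l) = Φ z) (c : ℂ) :
    ∫ z in parallelogram δ τ, Φ (z + c) = ∫ z in parallelogram δ τ, Φ z := by
  have h0 := isAddFundamentalDomain_parallelogram_add δ τ 0
  have h1 := isAddFundamentalDomain_parallelogram_add δ τ (-c)
  -- The parallelogram and its translate are fundamental domains of the same lattice, so an
  -- invariant function has equal integrals over them.
  have h := h0.setIntegral_eq h1 (f := Φ) fun l z => by
    rw [AddSubgroup.vadd_def, vadd_eq_add, add_comm]; exact hΦ l l.2 z
  simp only [add_zero, Set.preimage_id'] at h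
  rw [h, ← (measurePreserving_add_right volume c).setIntegral_preimage_emb
    (measurableEmbedding_addRight c) Φ ((fun z => z + -c) ⁻¹' parallelogram δ τ)]
  congr 2
  ext z; simp

lemma isBounded_parallelogram (δ : ℕ) [NeZero δ] (τ : ℍ) :
    Bornology.IsBounded (parallelogram δ τ) := by
  refine (Metric.isBounded_closedBall (x := (0 : ℂ)) (r := δ + ‖(τ : ℂ)‖)).subset ?_
  rintro _ ⟨x, hx, y, hy, rfl⟩
  rw [mem_closedBall_zero_iff]
  refine (norm_add_le _ _).trans ?_
  rw [norm_mul, norm_mul, Complex.norm_real, Complex.norm_real, Real.norm_of_nonneg hx.1,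
    Real.norm_of_nonneg hy.1, Complex.norm_natCast]
  exact add_le_add (mul_le_of_le_one_left (by positivity) hx.2.le)
    (mul_le_of_le_one_left (by positivity) hy.2.le)

open MeasureTheory in
lemma integrableOn_parallelogram_of_continuous {δ : ℕ} [NeZero δ] {τ : ℍ} {E : Type*}
    [NormedAddCommGroup E] {f : ℂ → E}
    (hf : Continuous f) : IntegrableOn f (parallelogram δ τ) volume := by
  obtain ⟨r, hr⟩ := (isBounded_parallelogram δ τ).subset_closedBall (0 : ℂ)
  exact (hf.continuousOn.integrableOn_compact (isCompact_closedBall 0 r)).mono_set hr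

open MeasureTheory in
/-- An entire function whose weighted `L²`-norm vanishes is zero. -/
lemma eq_zero_of_setIntegral_eq_zero {δ : ℕ} [NeZero δ] {τ : ℍ} {h : ℂ → ℝ} (hc : Continuous h)
    (hpos : ∀ z, 0 < h z) {f : ℂ → ℂ} (hf : Differentiable ℂ f)
    (h0 : ∫ z in parallelogram δ τ, h z * ‖f z‖ ^ 2 = 0) : f = 0 := by
  have hfc := hf.continuous
  have hcont : Continuous fun z => h z * ‖f z‖ ^ 2 := by fun_prop
  have hae := (setIntegral_eq_zero_iff_of_nonneg_ae
    (Filter.Eventually.of_forall fun z => by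
      have := (hpos z).le
      simp only [Pi.zero_apply]; positivity)
    (integrableOn_parallelogram_of_continuous (δ := δ) (τ := τ) hcont)).1 h0
  -- On this open part of the parallelogram, almost everywhere zero and continuous means zero; the
  -- identity theorem extends this to `ℂ`.
  set V : Set ℂ := deltaCoord δ τ ⁻¹' Set.Ioo 0 1 ∩ tauCoord τ ⁻¹' Set.Ioo 0 1 with hV
  have hVo : IsOpen V := (isOpen_Ioo.preimage (continuous_deltaCoord δ τ)).inter
    (isOpen_Ioo.preimage (continuous_tauCoord τ))
  have hVsub : V ⊆ parallelogram δ τ := fun z hz => mem_parallelogram.2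
    ⟨Set.Ioo_subset_Ico_self hz.1, Set.Ioo_subset_Ico_self hz.2⟩
  have hae' : (fun z => h z * ‖f z‖ ^ 2) =ᵐ[volume.restrict V] fun _ => 0 :=
    ae_restrict_of_ae_restrict_of_subset hVsub hae
  have heq := Measure.eqOn_open_of_ae_eq hae' hVo hcont.continuousOn continuousOn_const
  have hz : ((1 / 2 : ℝ) : ℂ) * δ + ((1 / 2 : ℝ) : ℂ) * τ ∈ V := by
    refine ⟨?_, ?_⟩
    · rw [Set.mem_preimage, deltaCoord_real_add]; norm_num
    · rw [Set.mem_preimage, tauCoord_real_add]; norm_num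
  refine AnalyticOnNhd.eq_of_eventuallyEq (hf.differentiableOn.analyticOnNhd isOpen_univ)
    (fun _ _ => analyticAt_const) 
    (z₀ := ((1 / 2 : ℝ) : ℂ) * δ + ((1 / 2 : ℝ) : ℂ) * τ) ?_
  filter_upwards [hVo.mem_nhds hz] with z hz
  have h1 := heq hz
  have h2 := (hpos z).ne'
  simpa [h2] using h1

/-! ### Local holomorphic frames of `E'` -/

/-- The fibre `E'_μ` is the space of translates of sections of `L₀` by `μ`. -/
lemma mem_fibre_iff {δ : ℕ} [NeZero δ] {τ : ℍ} {μ : ℂ} {f : ℂ → ℂ} :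
    f ∈ fibre δ τ μ ↔ (fun w => f (w - μ)) ∈ (L₀ δ τ).globalSections := by
  have hmult : ∀ (l : lattice δ τ) (z : ℂ), ((Etilde' δ τ).restrictLeft μ).mult l z =
      (L₀ δ τ).mult l (z + μ) := by
    intro l z
    simp only [LineBundle.restrictLeft, Etilde', LineBundle.tensor, pullbackL₀, pullbackP,
      LineBundle.pullback, L₀, poincare]
    rw [← Complex.exp_add]
    congr 1
    simp [phiLift, tauCoord]; ring
  constructor
  · rintro ⟨h1, h2⟩
    refine ⟨((differentiableOn_univ.1 h1).comp
      (differentiable_id.sub_const μ)).differentiableOn, fun l w _ => ?_⟩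
    have := h2 l (w - μ) trivial
    rw [hmult, sub_add_cancel] at this
    simp only [add_sub_right_comm w, this]
  · rintro ⟨h1, h2⟩
    have h3 := (differentiableOn_univ.1 h1).comp (differentiable_id.add_const μ)
    refine ⟨?_, fun l z _ => ?_⟩
    · simpa [Function.comp_def] using h3.differentiableOn (s := Set.univ)
    · have := h2 l (z + μ) trivial
      rw [hmult]
      simpa [add_right_comm z μ] using this

/-! ### Annuli in the torus and nowhere zero sections of `L₀^*` over them -/

lemma exp_eq_exp_of_sub_eq {x y : ℂ} (n : ℤ) (h : x = y + n * (2 * π * Complex.I)) :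
    Complex.exp x = Complex.exp y :=
  Complex.exp_eq_exp_iff_exists_int.2 ⟨n, h⟩

/-- The height of `μ` over `p`, measured in units of `τ`, and shifted by `1/2`. -/
def height (τ : ℍ) (p μ : ℂ) : ℝ := tauCoord τ (μ - p) + 1 / 2

lemma continuous_height (τ : ℍ) (p : ℂ) : Continuous (height τ p) :=
  ((continuous_tauCoord τ).comp (continuous_id.sub continuous_const)).add_const _

/-- The annulus in the torus which is the complement of the circle opposite to `[p]`. -/
def annulus (δ : ℕ) (τ : ℍ) (p : ℂ) : Set (Torus δ τ) :=
  QuotientAddGroup.mk '' {μ | (⌊height τ p μ⌋ : ℝ) < height τ p μ}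

lemma height_add {τ : ℍ} (p μ l : ℂ) :
    height τ p (μ + l) = height τ p μ + tauCoord τ l := by
  simp only [height, add_sub_right_comm μ l p, tauCoord_add]; ring

lemma isOpen_floor_lt : IsOpen {x : ℝ | (⌊x⌋ : ℝ) < x} := by
  have : {x : ℝ | (⌊x⌋ : ℝ) < x} = (Set.range ((↑) : ℤ → ℝ))ᶜ := by
    ext x
    simp only [Set.mem_ofPred_eq, Set.mem_compl_iff, Set.mem_range, not_exists]
    constructor
    · rintro h n rfl
      simp at h
    · intro h
      exact lt_of_le_of_ne (Int.floor_le x) (h _)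
  rw [this]
  exact (Int.isClosedEmbedding_coe_real.isClosed_range).isOpen_compl

lemma isOpen_annulus (δ : ℕ) (τ : ℍ) (p : ℂ) : IsOpen (annulus δ τ p) :=
  QuotientAddGroup.isOpenMap_coe _ (isOpen_floor_lt.preimage (continuous_height τ p))

/-- Lattice vectors change the height by integers, so having non-integral height is invariant under
`Λ`. -/
lemma mem_lift_annulus {δ : ℕ} {τ : ℍ} {p μ : ℂ} : μ ∈ lift (annulus δ τ p) ↔
    (⌊height τ p μ⌋ : ℝ) < height τ p μ := by
  constructor
  · rintro ⟨ν, hν, h⟩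
    have hl := QuotientAddGroup.eq.1 h
    obtain ⟨a, b, hb, -⟩ := exists_of_mem_lattice hl
    have : height τ p μ = height τ p ν + b := by
      rw [← hb, ← height_add]; simp
    rw [this]
    simpa using hν
  · exact fun h => ⟨μ, h, rfl⟩

/-- The shift by `1 / 2` gives `p` height `1 / 2`, away from the excluded integers. -/
lemma mk_mem_annulus (δ : ℕ) (τ : ℍ) (p : ℂ) : (QuotientAddGroup.mk p : Torus δ τ) ∈ annulus δ τ p :=
  ⟨p, by norm_num [height, tauCoord], rfl⟩

/-- The factor which makes theta functions quasi-periodic in the parameter, on an annulus. -/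
def frameFactor (τ : ℍ) (p μ : ℂ) : ℂ :=
  -- A shift of `μ` by `aδ + bτ` raises the floor by `b` and multiplies this expression by `e^{2πi b
  -- μ + πi b² τ}`, the inverse of the multiplier of `L₀`.
  Complex.exp (-(π * Complex.I * ⌊height τ p μ⌋ ^ 2 * τ) +
    2 * π * Complex.I * ⌊height τ p μ⌋ * μ)

lemma differentiableOn_frameFactor (δ : ℕ) (τ : ℍ) (p : ℂ) :
    DifferentiableOn ℂ (frameFactor τ p) (lift (annulus δ τ p)) := by
  intro μ hμ
  rw [mem_lift_annulus] at hμ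
  -- Off the integers the floor is locally constant, so locally the factor is the exponential of an
  -- affine function.
  have h1 : ∀ᶠ ν in nhds μ, ⌊height τ p ν⌋ = ⌊height τ p μ⌋ := by
    filter_upwards [(continuous_height τ p).continuousAt.preimage_mem_nhds
      (Ioo_mem_nhds hμ (Int.lt_floor_add_one (height τ p μ)))] with ν hν
    exact Int.floor_eq_iff.2 ⟨hν.1.le, hν.2⟩
  have h2 : frameFactor τ p =ᶠ[nhds μ] fun ν =>
      Complex.exp (-(π * Complex.I * ⌊height τ p μ⌋ ^ 2 * τ) +
        2 * π * Complex.I * ⌊height τ p μ⌋ * ν) := by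
    filter_upwards [h1] with ν hν
    rw [frameFactor, hν]
  exact (DifferentiableAt.congr_of_eventuallyEq (by fun_prop) h2).differentiableWithinAt

/-- The frame of `E'` given by theta functions, over an annulus. -/
def thetaFrame (δ : ℕ) (τ : ℍ) (p : ℂ) (m : Fin δ) (q : ℂ × ℂ) : ℂ :=
  frameFactor τ p q.2 * thetaChar δ τ m (q.1 + q.2)

lemma isSection_thetaFrame (δ : ℕ) [NeZero δ] (τ : ℍ) (p : ℂ) (m : Fin δ) :
    IsSection (annulus δ τ p) (thetaFrame δ τ p m) := by
  constructor
  · refine DifferentiableOn.mul ?_ ?_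
    · exact (differentiableOn_frameFactor δ τ p).comp differentiableOn_snd fun q hq => hq.2
    · exact ((differentiable_thetaChar δ τ m).comp
        (differentiable_fst.add differentiable_snd)).differentiableOn
  · rintro ⟨⟨l, l'⟩, hl⟩ ⟨z, μ⟩ -
    obtain ⟨a, b, h, -⟩ := exists_of_mem_lattice hl.1
    obtain ⟨a', b', h', e'⟩ := exists_of_mem_lattice hl.2
    have hL := (thetaChar_mem δ τ m).2 ⟨l + l', add_mem hl.1 hl.2⟩ (z + μ) trivial
    simp only at h h' e'
    simp only [thetaFrame, Etilde', LineBundle.tensor, pullbackL₀, pullbackP,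
      LineBundle.pullback, L₀, poincare, frameFactor, Prod.mk_add_mk] at hL ⊢
    rw [show z + l + (μ + l') = z + μ + (l + l') by ring, hL, height_add, h',
      Int.floor_add_intCast, ← mul_assoc, ← mul_assoc, ← Complex.exp_add, ← Complex.exp_add,
      ← Complex.exp_add]
    congr 1
    -- The two exponents differ by the `a' * δ` part of `l'` multiplied by the new floor `⌊height τ
    -- p μ⌋ + b'`.
    refine exp_eq_exp_of_sub_eq ((⌊height τ p μ⌋ + b') * a' * δ) ?_
    simp [phiLift, tauCoord_add, h, h']
    rw [e']
    ring

lemma thetaChar_translate_basis (δ : ℕ) [NeZero δ] (τ : ℍ) (μ c : ℂ) (hc : c ≠ 0) :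
    LinearIndependent ℂ (fun (m : Fin δ) z => c * thetaChar δ τ m (z + μ)) ∧
      Submodule.span ℂ (Set.range fun (m : Fin δ) z => c * thetaChar δ τ m (z + μ)) =
        fibre δ τ μ := by
  constructor
  · rw [Fintype.linearIndependent_iff]
    intro g hg
    refine Fintype.linearIndependent_iff.1 (linearIndependent_thetaChar δ τ) g ?_
    funext w
    have := congrFun hg (w - μ)
    simp only [Finset.sum_apply, Pi.smul_apply, smul_eq_mul, sub_add_cancel, Pi.zero_apply] at this ⊢
    simp_rw [mul_left_comm _ c] at this
    rw [← Finset.mul_sum] at this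
    exact (mul_eq_zero.1 this).resolve_left hc
  · apply le_antisymm
    · rw [Submodule.span_le]
      rintro _ ⟨m, rfl⟩
      refine mem_fibre_iff.2 ?_
      simp only [sub_add_cancel]
      exact Submodule.smul_mem _ c (thetaChar_mem δ τ m)
    · intro f hf
      obtain ⟨a, ha⟩ := exists_eq_sum_thetaChar (mem_fibre_iff.1 hf)
      refine (Submodule.mem_span_range_iff_exists_fun ℂ).2 ⟨fun m => c⁻¹ * a m, ?_⟩
      funext z
      have := congrFun ha (z + μ)
      simp only [add_sub_cancel_right] at this
      rw [this]
      simp only [Finset.sum_apply, Pi.smul_apply, smul_eq_mul]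
      exact Finset.sum_congr rfl fun _ _ => by field_simp

lemma isFrame_thetaFrame (δ : ℕ) [NeZero δ] (τ : ℍ) (p : ℂ) :
    IsFrame (annulus δ τ p) (thetaFrame δ τ p) where
  isSection := isSection_thetaFrame δ τ p
  linearIndependent μ _ := (thetaChar_translate_basis δ τ μ (frameFactor τ p μ) (Complex.exp_ne_zero _)).1
  span_eq μ _ := (thetaChar_translate_basis δ τ μ (frameFactor τ p μ) (Complex.exp_ne_zero _)).2

/-! ### The Gram matrix of the `L²`-metric -/

open MeasureTheory in
/-- Gram matrices of linearly independent entire functions are positive definite. -/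
lemma posDef_of_linearIndependent (δ : ℕ) [NeZero δ] (τ : ℍ) {n : ℕ} {h : ℂ → ℝ}
    (hc : Continuous h) (hpos : ∀ z, 0 < h z) {F : Fin n → ℂ → ℂ}
    (hF : ∀ i, Differentiable ℂ (F i)) (hli : LinearIndependent ℂ F) :
    (Matrix.of fun i j => ∫ z in parallelogram δ τ, (h z : ℂ) * F i z * conj (F j z)).PosDef := by
  have hFc : ∀ i, Continuous (F i) := fun i => (hF i).continuous
  refine Matrix.PosDef.of_dotProduct_mulVec_pos ?_ fun x hx => ?_
  · ext i j
    simp only [Matrix.conjTranspose_apply, Matrix.of_apply, ← starRingEnd_apply]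
    rw [← integral_conj]
    congr 1; funext z
    simp only [map_mul, Complex.conj_ofReal, Complex.conj_conj]
    ring
  -- The inner product is linear in its first argument, so the row vector `star x` requires
  -- conjugated coefficients: `x^* H x` is the squared norm of this `f`.
  · set f : ℂ → ℂ := ∑ i, conj (x i) • F i with hf
    have hfd : Differentiable ℂ f := Differentiable.sum fun i _ => (hF i).const_smul _
    have hquad : star x ⬝ᵥ (Matrix.of fun i j =>
        ∫ z in parallelogram δ τ, (h z : ℂ) * F i z * conj (F j z)).mulVec x =
        ((∫ z in parallelogram δ τ, h z * ‖f z‖ ^ 2 : ℝ) : ℂ) := by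
      have hint : ∀ i j, IntegrableOn
          (fun z => conj (x i) * ((h z : ℂ) * F i z * conj (F j z) * x j))
          (parallelogram δ τ) volume := fun i j => by
        apply integrableOn_parallelogram_of_continuous
        have := hFc i
        have := Complex.continuous_conj.comp (hFc j)
        have := Complex.continuous_ofReal.comp hc
        simp only [Function.comp_def] at *
        fun_prop
      simp only [dotProduct, Matrix.mulVec, Matrix.of_apply, Finset.mul_sum, Pi.star_apply,
        ← starRingEnd_apply]
      rw [← integral_complex_ofReal]
      simp_rw [← integral_mul_const, ← integral_const_mul]
      rw [Finset.sum_congr rfl fun i _ => (integral_finsetSum _ fun j _ => hint i j).symm,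
        ← integral_finsetSum _ fun i _ => integrable_finsetSum _ fun j _ => hint i j]
      congr 1; funext z
      have : ((‖f z‖ ^ 2 : ℝ) : ℂ) = f z * conj (f z) := by
        rw [Complex.mul_conj, Complex.normSq_eq_norm_sq]
      rw [Complex.ofReal_mul, this, hf]
      simp only [Finset.sum_apply, Pi.smul_apply, smul_eq_mul, map_sum, map_mul, Complex.conj_conj]
      rw [Finset.sum_mul_sum, Finset.mul_sum]
      refine Finset.sum_congr rfl fun i _ => ?_
      rw [Finset.mul_sum]
      exact Finset.sum_congr rfl fun j _ => by ring
    rw [hquad, Complex.zero_lt_real]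
    refine lt_of_le_of_ne (setIntegral_nonneg (measurableSet_parallelogram δ τ) fun z _ => ?_) ?_
    · have := (hpos z).le; positivity
    · intro h0
      have hf0 := eq_zero_of_setIntegral_eq_zero hc hpos hfd h0.symm
      apply hx
      funext i
      have := Fintype.linearIndependent_iff.1 hli _ hf0 i
      simpa using this

lemma isOpen_lift {δ : ℕ} {τ : ℍ} {U : Set (Torus δ τ)} (hU : IsOpen U) : IsOpen (lift U) :=
  hU.preimage continuous_quot_mk

section Frame

variable {δ : ℕ} [NeZero δ] {τ : ℍ} {U : Set (Torus δ τ)} {s : Fin δ → ℂ × ℂ → ℂ}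

lemma IsFrame.mem_fibre {n : ℕ} {s : Fin n → ℂ × ℂ → ℂ} (hs : IsFrame U s) {μ : ℂ}
    (hμ : μ ∈ lift U) (i : Fin n) : (fun z => s i (z, μ)) ∈ fibre δ τ μ := by
  rw [← hs.span_eq μ hμ]
  exact Submodule.subset_span ⟨i, rfl⟩

lemma IsFrame.posDef_gram {n : ℕ} {s : Fin n → ℂ × ℂ → ℂ} (hs : IsFrame U s) {μ : ℂ}
    (hμ : μ ∈ lift U) : (gram δ τ s μ).PosDef := by
  refine posDef_of_linearIndependent δ τ (h := fun z => (metricEtilde' δ τ).weight (z, μ))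
    (F := fun i z => s i (z, μ)) ?_ (fun z => (metricEtilde' δ τ).pos _)
    (fun i => differentiableOn_univ.1 (hs.mem_fibre hμ i).1) (hs.linearIndependent μ hμ)
  exact (metricEtilde' δ τ).smooth.continuous.comp (by fun_prop)

/-- The coordinates of the elements of a frame with respect to theta functions. -/
def frameMatrix (δ : ℕ) (τ : ℍ) (s : Fin δ → ℂ × ℂ → ℂ) (μ : ℂ) : Matrix (Fin δ) (Fin δ) ℂ :=
  Matrix.of fun i m => thetaCoord δ τ m fun w => s i (w - μ, μ)

/-- Each coordinate is a fixed finite combination of values of `s i` at points `(c - μ, μ)`, which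
depend holomorphically on `μ`. -/
lemma IsFrame.differentiableOn_frameMatrix (hs : IsFrame U s) (i m : Fin δ) :
    DifferentiableOn ℂ (fun μ => frameMatrix δ τ s μ i m) (lift U) := by
  simp only [frameMatrix, Matrix.of_apply, thetaCoord, LinearMap.coe_mk, AddHom.coe_mk]
  refine DifferentiableOn.const_mul (DifferentiableOn.fun_sum fun j _ =>
    DifferentiableOn.const_mul ?_ _) _
  refine (hs.isSection i).1.comp (f := fun μ => (thetaPoint δ τ m + j - μ, μ))
    (Differentiable.differentiableOn (by fun_prop)) fun μ hμ => ⟨trivial, hμ⟩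

/-- The inner products of the theta functions with respect to the metric of `L₀`. -/
def thetaGram (δ : ℕ) (τ : ℍ) : Matrix (Fin δ) (Fin δ) ℂ :=
  Matrix.of fun m n => ∫ z in parallelogram δ τ,
    ((metricL₀ δ τ).weight z : ℂ) * thetaChar δ τ m z * conj (thetaChar δ τ n z)

/-- The inverse of the weight of the metric of `L₀`. -/
def dualWeight (τ : ℍ) (μ : ℂ) : ℝ := Real.exp (2 * π / τ.im * μ.im ^ 2)

/-- Completing the square: `z₂² + 2 z₂ μ₂ = (z₂ + μ₂)² - μ₂²`. The leftover term is the source of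
all the curvature. -/
lemma weight_metricEtilde' (z μ : ℂ) : (metricEtilde' δ τ).weight (z, μ) =
    dualWeight τ μ * (metricL₀ δ τ).weight (z + μ) := by
  simp only [metricEtilde', HermitianMetric.tensor, HermitianMetric.pullback, metricL₀, metricP,
    dualWeight, ← Real.exp_add]
  congr 1
  simp; ring

open MeasureTheory in
-- After the substitution `w = z + μ` the integrand is doubly periodic, so the domain need not move
-- with `μ`. Expanding in theta functions leaves `μ` only in the coordinates and in the scalar
-- weight.
lemma IsFrame.gram_eq (hs : IsFrame U s) {μ : ℂ} (hμ : μ ∈ lift U) :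
    gram δ τ s μ = (dualWeight τ μ : ℂ) •
      (frameMatrix δ τ s μ * thetaGram δ τ * (frameMatrix δ τ s μ).conjTranspose) := by
  ext i j
  have hS : ∀ i, (fun w => s i (w - μ, μ)) ∈ (L₀ δ τ).globalSections := fun i =>
    mem_fibre_iff.1 (hs.mem_fibre hμ i)
  set Φ : ℂ → ℂ := fun w => ((metricL₀ δ τ).weight w : ℂ) * s i (w - μ, μ) *
    conj (s j (w - μ, μ)) with hΦ
  have hper : ∀ l ∈ lattice δ τ, ∀ z, Φ (z + l) = Φ z := by
    intro l hl z
    have h1 := (hS i).2 ⟨l, hl⟩ z trivial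
    have h2 := (hS j).2 ⟨l, hl⟩ z trivial
    have h3 := (metricL₀ δ τ).compat ⟨l, hl⟩ z
    simp only at h1 h2 h3
    simp only [hΦ]
    rw [h1, h2, ← h3, map_mul]
    have h4 := Complex.mul_conj ((L₀ δ τ).mult ⟨l, hl⟩ z)
    rw [Complex.normSq_eq_norm_sq] at h4
    push_cast at h4 ⊢
    rw [← h4]; ring
  have hexp : ∀ z, Φ z = ∑ m : Fin δ, ∑ n : Fin δ, frameMatrix δ τ s μ i m *
      (((metricL₀ δ τ).weight z : ℂ) * thetaChar δ τ m z * conj (thetaChar δ τ n z)) *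
        conj (frameMatrix δ τ s μ j n) := by
    intro z
    simp only [hΦ, frameMatrix, Matrix.of_apply]
    rw [eq_sum_thetaCoord (hS i) z, eq_sum_thetaCoord (hS j) z, map_sum, mul_assoc,
      Finset.sum_mul_sum, Finset.mul_sum]
    refine Finset.sum_congr rfl fun m _ => ?_
    rw [Finset.mul_sum]
    refine Finset.sum_congr rfl fun n _ => ?_
    rw [map_mul]; ring
  have hint : ∀ m n : Fin δ, IntegrableOn (fun z => frameMatrix δ τ s μ i m *
      (((metricL₀ δ τ).weight z : ℂ) * thetaChar δ τ m z * conj (thetaChar δ τ n z)) *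
        conj (frameMatrix δ τ s μ j n)) (parallelogram δ τ) volume := fun m n => by
    apply integrableOn_parallelogram_of_continuous
    have := (differentiable_thetaChar δ τ m).continuous
    have := Complex.continuous_conj.comp (differentiable_thetaChar δ τ n).continuous
    have := Complex.continuous_ofReal.comp (metricL₀ δ τ).smooth.continuous
    simp only [Function.comp_def] at *
    fun_prop
  have hΦint : ∫ z in parallelogram δ τ, Φ z =
      (frameMatrix δ τ s μ * thetaGram δ τ * (frameMatrix δ τ s μ).conjTranspose) i j := by
    simp_rw [hexp]
    rw [integral_finsetSum _ fun m _ => integrable_finsetSum _ fun n _ => hint m n,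
      Finset.sum_congr rfl fun m _ => integral_finsetSum _ fun n _ => hint m n, Finset.sum_comm]
    simp only [integral_mul_const, integral_const_mul, Matrix.mul_apply, Matrix.conjTranspose_apply,
      Finset.sum_mul, thetaGram, Matrix.of_apply, starRingEnd_apply]
  rw [Matrix.smul_apply, ← hΦint, ← setIntegral_parallelogram_add δ τ hper μ, smul_eq_mul,
    ← integral_const_mul]
  simp only [gram, l2Inner, Matrix.of_apply]
  congr 1; funext z
  rw [weight_metricEtilde']
  simp only [hΦ, add_sub_cancel_right]
  push_cast; ring

end Frame

/-! ### Calculus of `∂` and `d` -/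

lemma del_mul {f g : ℂ → ℂ} {μ : ℂ} (hf : DifferentiableAt ℝ f μ) (hg : DifferentiableAt ℝ g μ)
    (v : ℂ) : del (fun ν => f ν * g ν) μ v = del f μ v * g μ + f μ * del g μ v := by
  simp only [del, fderiv_fun_mul hf hg, add_apply,
    smul_apply, smul_eq_mul]
  ring

lemma del_sum {ι : Type*} {t : Finset ι} {f : ι → ℂ → ℂ} {μ : ℂ}
    (hf : ∀ i ∈ t, DifferentiableAt ℝ (f i) μ) (v : ℂ) :
    del (fun ν => ∑ i ∈ t, f i ν) μ v = ∑ i ∈ t, del (f i) μ v := by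
  simp only [del, fderiv_fun_sum hf, sum_apply, Finset.mul_sum,
    ← Finset.sum_sub_distrib, Finset.sum_div]

lemma fderiv_real_of_holomorphic {f : ℂ → ℂ} {μ : ℂ} (hf : DifferentiableAt ℂ f μ) (v : ℂ) :
    fderiv ℝ f μ v = deriv f μ * v := by
  rw [hf.fderiv_restrictScalars ℝ]
  simp [mul_comm]

lemma del_of_holomorphic {f : ℂ → ℂ} {μ : ℂ} (hf : DifferentiableAt ℂ f μ) (v : ℂ) :
    del f μ v = deriv f μ * v := by
  simp only [del, fderiv_real_of_holomorphic hf]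
  linear_combination (-(1 / 2 : ℂ) * deriv f μ * v) * Complex.I_sq

lemma hasFDerivAt_conj {f : ℂ → ℂ} {μ : ℂ} (hf : DifferentiableAt ℝ f μ) :
    HasFDerivAt (fun ν => conj (f ν)) (Complex.conjCLE.toContinuousLinearMap ∘L fderiv ℝ f μ) μ :=
  Complex.conjCLE.hasFDerivAt.comp μ hf.hasFDerivAt

lemma del_conj_of_holomorphic {f : ℂ → ℂ} {μ : ℂ} (hf : DifferentiableAt ℂ f μ) (v : ℂ) :
    del (fun ν => conj (f ν)) μ v = 0 := by
  simp only [del, (hasFDerivAt_conj (hf.restrictScalars ℝ)).fderiv,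
    ContinuousLinearMap.comp_apply, fderiv_real_of_holomorphic hf]
  simp
  linear_combination (conj (deriv f μ) * conj v) * Complex.I_sq

lemma hasFDerivAt_im_ofReal (μ : ℂ) : HasFDerivAt (fun ν : ℂ => (ν.im : ℂ))
    (Complex.ofRealCLM ∘L Complex.imCLM) μ :=
  (Complex.ofRealCLM ∘L Complex.imCLM).hasFDerivAt

/-- The holomorphic derivative of the logarithm of the inverse of the weight of `L₀`. -/
lemma del_dualWeight (τ : ℍ) (μ v : ℂ) : del (fun ν => (dualWeight τ ν : ℂ)) μ v =
    (-2 * π * Complex.I / τ.im * μ.im * v) * dualWeight τ μ := by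
  have h1 : (fun ν => (dualWeight τ ν : ℂ)) =
      fun ν : ℂ => Complex.exp (2 * π / τ.im * (ν.im : ℂ) ^ 2) := by
    funext ν; simp [dualWeight]
  have h2 := (((hasFDerivAt_im_ofReal μ).pow 2).const_mul (2 * π / τ.im : ℂ)).cexp
  have h3 : (dualWeight τ μ : ℂ) = Complex.exp (2 * π / τ.im * (μ.im : ℂ) ^ 2) := congrFun h1 μ
  rw [h1, del, h2.fderiv, h3]
  simp
  linear_combination (2 * π / τ.im * μ.im * v.im *
    Complex.exp (2 * π / τ.im * (μ.im : ℂ) ^ 2)) * Complex.I_sq - (2 * π * Complex.I / τ.im * μ.im *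
    Complex.exp (2 * π / τ.im * (μ.im : ℂ) ^ 2)) * Complex.re_add_im v

/-- The curvature of `L₀`. -/
lemma curvature_metricL₀ (δ : ℕ) (τ : ℍ) (μ v w : ℂ) :
    (metricL₀ δ τ).curvature μ v w = (π / τ.im : ℂ) * dWedgeDbar v w := by
  have h1 : (fun ν => ((Real.log ((metricL₀ δ τ).weight ν) : ℝ) : ℂ)) =
      fun ν : ℂ => (-2 * π / τ.im : ℂ) * (ν.im : ℂ) ^ 2 := by
    funext ν; simp [metricL₀]
  have h2 : ∀ u, (fun ν => delbar (fun ν : ℂ => (-2 * π / τ.im : ℂ) * (ν.im : ℂ) ^ 2) ν u) =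
      fun ν => (-2 * π / τ.im * Complex.I * conj u) * (ν.im : ℂ) := by
    intro u; funext ν
    rw [delbar, (((hasFDerivAt_im_ofReal ν).pow 2).const_mul (-2 * π / τ.im : ℂ)).fderiv]
    have hc : conj u = u.re - u.im * Complex.I := by
      apply Complex.ext <;> simp
    rw [hc]
    simp
    linear_combination (-2 * π / τ.im * ν.im * u.im) * Complex.I_sq
  have h3 : ∀ u x : ℂ, fderiv ℝ (fun ν : ℂ => (-2 * π / τ.im * Complex.I * conj u) * (ν.im : ℂ)) μ x =
      (-2 * π / τ.im * Complex.I * conj u) * x.im := by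
    intro u x
    rw [((hasFDerivAt_im_ofReal μ).const_mul _).fderiv]
    simp
  rw [HermitianMetric.curvature, extDer, h1, h2, h2, h3, h3, dWedgeDbar]
  have hc : ∀ u : ℂ, conj u = u.re - u.im * Complex.I := fun u => by
    apply Complex.ext <;> simp
  rw [hc v, hc w]
  linear_combination (π / τ.im * (w.re - w.im * Complex.I)) * Complex.re_add_im v -
    (π / τ.im * (v.re - v.im * Complex.I)) * Complex.re_add_im w

/-! ### Chern curvature of a twisted constant metric -/

lemma differentiableAt_det {n : Type*} [Fintype n] [DecidableEq n] {A : ℂ → Matrix n n ℂ} {μ : ℂ}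
    (hA : ∀ i j, DifferentiableAt ℂ (fun ν => A ν i j) μ) :
    DifferentiableAt ℂ (fun ν => (A ν).det) μ := by
  simp only [Matrix.det_apply]
  exact DifferentiableAt.fun_sum fun σ _ =>
    (DifferentiableAt.fun_finsetProd fun i _ => hA _ _).const_smul _

lemma differentiableAt_inv_apply {n : Type*} [Fintype n] [DecidableEq n] {A : ℂ → Matrix n n ℂ}
    {μ : ℂ} (hA : ∀ i j, DifferentiableAt ℂ (fun ν => A ν i j) μ) (h0 : (A μ).det ≠ 0) (i j : n) :
    DifferentiableAt ℂ (fun ν => (A ν)⁻¹ i j) μ := by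
  simp only [Matrix.inv_def, Matrix.smul_apply, Ring.inverse_eq_inv', smul_eq_mul,
    Matrix.adjugate_apply]
  refine ((differentiableAt_det hA).inv h0).mul (differentiableAt_det fun k l => ?_)
  simp only [Matrix.updateRow_apply]
  split_ifs
  · exact differentiableAt_const _
  · exact hA k l

section Twisted

variable {n : ℕ} {V : Set ℂ} {τ : ℍ} {H A : ℂ → Matrix (Fin n) (Fin n) ℂ}
  {G : Matrix (Fin n) (Fin n) ℂ}

lemma contDiff_dualWeight (τ : ℍ) : ContDiff ℝ ∞ fun μ => (dualWeight τ μ : ℂ) := by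
  have h : ContDiff ℝ ∞ fun z : ℂ => z.im := Complex.imCLM.contDiff
  exact Complex.ofRealCLM.contDiff.comp
    (Real.contDiff_exp.comp (contDiff_const.mul (h.pow 2)))

lemma contDiffOn_twisted (hV : IsOpen V) (hA : ∀ i j, DifferentiableOn ℂ (fun μ => A μ i j) V)
    (hH : ∀ μ ∈ V, H μ = (dualWeight τ μ : ℂ) • (A μ * G * (A μ).conjTranspose)) (i j : Fin n) :
    ContDiffOn ℝ ∞ (fun μ => H μ i j) V := by
  have hA' : ∀ i j, ContDiffOn ℝ ∞ (fun μ => A μ i j) V := fun i j =>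
    ((hA i j).contDiffOn hV).restrict_scalars ℝ
  have : Set.EqOn (fun μ => H μ i j) (fun μ => (dualWeight τ μ : ℂ) *
      ∑ l, (∑ k, A μ i k * G k l) * conj (A μ j l)) V := fun μ hμ => by
    simp only [hH μ hμ, Matrix.smul_apply, smul_eq_mul, Matrix.mul_apply,
      Matrix.conjTranspose_apply, starRingEnd_apply]
  refine ContDiffOn.congr ?_ this
  exact (contDiff_dualWeight τ).contDiffOn.mul (ContDiffOn.sum fun l _ =>
    (ContDiffOn.sum fun k _ => (hA' i k).mul contDiffOn_const).mul
      (Complex.conjCLE.contDiff.comp_contDiffOn (hA' j l)))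

/-- `∂` annihilates the antiholomorphic factor `A^*`, so `∂H = ∂A · (φ G A^*) + (∂ log φ) H`, and `φ
G A^* H⁻¹ = A⁻¹`. The scalar `-2πi μ₂ / τ₂` is the coefficient of `dμ` in `∂ log φ`. -/
lemma chernConnection_twisted (hV : IsOpen V)
    (hA : ∀ i j, DifferentiableOn ℂ (fun μ => A μ i j) V)
    (hH : ∀ μ ∈ V, H μ = (dualWeight τ μ : ℂ) • (A μ * G * (A μ).conjTranspose)) {μ : ℂ}
    (hμ : μ ∈ V) (hdet : (H μ).det ≠ 0) (v : ℂ) :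
    (A μ).det ≠ 0 ∧ chernConnection H μ v =
      v • (Matrix.of (fun i j => deriv (fun ν => A ν i j) μ) * (A μ)⁻¹ +
        (-2 * π * Complex.I / τ.im * μ.im : ℂ) • 1) := by
  have hdA : (A μ).det ≠ 0 := by
    intro h
    apply hdet
    rw [hH μ hμ, Matrix.det_smul, Matrix.det_mul, Matrix.det_mul, h]
    simp
  refine ⟨hdA, ?_⟩
  have hAμ : ∀ i j, DifferentiableAt ℂ (fun ν => A ν i j) μ := fun i j =>
    (hA i j).differentiableAt (hV.mem_nhds hμ)
  have hφ : DifferentiableAt ℝ (fun ν => (dualWeight τ ν : ℂ)) μ :=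
    (contDiff_dualWeight τ).differentiable (by simp) μ
  have hconj : ∀ i j, DifferentiableAt ℝ (fun ν => conj (A ν i j)) μ := fun i j =>
    (hasFDerivAt_conj ((hAμ i j).restrictScalars ℝ)).differentiableAt
  set K := G * (A μ).conjTranspose with hK
  have hdel : (Matrix.of fun i j => del (fun ν => H ν i j) μ v) =
      v • (Matrix.of (fun i j => deriv (fun ν => A ν i j) μ) * ((dualWeight τ μ : ℂ) • K) +
        (-2 * π * Complex.I / τ.im * μ.im : ℂ) • H μ) := by
    ext i j
    have heq : (fun ν => H ν i j) =ᶠ[nhds μ] fun ν => (dualWeight τ ν : ℂ) *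
        ∑ k, A ν i k * ∑ l, G k l * conj (A ν j l) := by
      filter_upwards [hV.mem_nhds hμ] with ν hν
      simp only [hH ν hν, Matrix.smul_apply, smul_eq_mul, Matrix.mul_assoc, Matrix.mul_apply,
        Matrix.conjTranspose_apply, starRingEnd_apply]
    have hKd : ∀ k, DifferentiableAt ℝ (fun ν => ∑ l, G k l * conj (A ν j l)) μ := fun k =>
      DifferentiableAt.fun_sum fun l _ => (hconj j l).const_mul _
    have hK0 : ∀ k, del (fun ν => ∑ l, G k l * conj (A ν j l)) μ v = 0 := fun k => by
      rw [del_sum fun l _ => (hconj j l).const_mul _]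
      refine Finset.sum_eq_zero fun l _ => ?_
      rw [del_mul (differentiableAt_const _) (hconj j l), del_conj_of_holomorphic (hAμ j l)]
      simp [del]
    have hterm : ∀ k, DifferentiableAt ℝ
        (fun ν => A ν i k * ∑ l, G k l * conj (A ν j l)) μ := fun k =>
      ((hAμ i k).restrictScalars ℝ).mul (hKd k)
    rw [Matrix.of_apply]
    have : del (fun ν => H ν i j) μ v = del (fun ν => (dualWeight τ ν : ℂ) *
        ∑ k, A ν i k * ∑ l, G k l * conj (A ν j l)) μ v := by
      simp only [del, heq.fderiv_eq]
    rw [this, del_mul hφ (DifferentiableAt.fun_sum fun k _ => hterm k), del_dualWeight,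
      del_sum fun k _ => hterm k]
    simp_rw [del_mul ((hAμ i _).restrictScalars ℝ) (hKd _), hK0, del_of_holomorphic (hAμ i _)]
    rw [Matrix.smul_apply, Matrix.add_apply, Matrix.smul_apply, heq.eq_of_nhds]
    simp only [Matrix.mul_apply, Matrix.of_apply, Matrix.smul_apply, hK, smul_eq_mul, mul_zero,
      add_zero, Matrix.conjTranspose_apply, ← starRingEnd_apply]
    rw [add_comm, mul_add]
    congr 1
    · rw [Finset.mul_sum, Finset.mul_sum]
      exact Finset.sum_congr rfl fun k _ => by ring
    · ring
  have hHK : H μ = A μ * ((dualWeight τ μ : ℂ) • K) := by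
    rw [hH μ hμ, hK, Matrix.mul_smul, Matrix.mul_assoc]
  have hKH : ((dualWeight τ μ : ℂ) • K) * (H μ)⁻¹ = (A μ)⁻¹ := by
    have h1 : A μ * (((dualWeight τ μ : ℂ) • K) * (H μ)⁻¹) = 1 := by
      rw [← Matrix.mul_assoc, ← hHK, Matrix.mul_nonsing_inv _ hdet.isUnit]
    exact (Matrix.inv_eq_right_inv h1).symm
  rw [chernConnection, hdel, Matrix.smul_mul, Matrix.add_mul, Matrix.mul_assoc, hKH,
    Matrix.smul_mul, Matrix.mul_nonsing_inv _ hdet.isUnit]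

/-- The connection is a matrix times `dμ`, so its wedge square vanishes. The holomorphic part `A'
A⁻¹` contributes a multiple of `dμ ∧ dμ = 0`; what remains is `c d(Im μ) ∧ dμ = (c / 2i) dμ ∧ dμ̄`,
with `c / 2i = -π / τ₂`. -/
lemma chernCurvature_twisted (hV : IsOpen V)
    (hA : ∀ i j, DifferentiableOn ℂ (fun μ => A μ i j) V)
    (hH : ∀ μ ∈ V, H μ = (dualWeight τ μ : ℂ) • (A μ * G * (A μ).conjTranspose))
    (hdet : ∀ μ ∈ V, (H μ).det ≠ 0) {μ : ℂ} (hμ : μ ∈ V) (v w : ℂ) :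
    chernCurvature H μ v w = (-(π / τ.im : ℂ) * dWedgeDbar v w) • 1 := by
  set Q : ℂ → Matrix (Fin n) (Fin n) ℂ := fun ν =>
    Matrix.of (fun i j => deriv (fun ν => A ν i j) ν) * (A ν)⁻¹ with hQ
  set c : ℂ := -2 * π * Complex.I / τ.im with hc
  have hconn : ∀ ν ∈ V, ∀ u, chernConnection H ν u = u • (Q ν + (c * ν.im) • 1) :=
    fun ν hν u => (chernConnection_twisted hV hA hH hν (hdet ν hν) u).2
  have hdA := (chernConnection_twisted hV hA hH hμ (hdet μ hμ) 0).1
  have hQd : ∀ i j, DifferentiableAt ℂ (fun ν => Q ν i j) μ := fun i j => by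
    simp only [hQ, Matrix.mul_apply, Matrix.of_apply]
    refine DifferentiableAt.fun_sum fun k _ => DifferentiableAt.mul ?_ ?_
    · exact ((hA i k).deriv hV).differentiableAt (hV.mem_nhds hμ)
    · exact differentiableAt_inv_apply
        (fun i j => (hA i j).differentiableAt (hV.mem_nhds hμ)) hdA k j
  have hfd : ∀ i j u x, fderiv ℝ (fun ν => chernConnection H ν u i j) μ x =
      u * (deriv (fun ν => Q ν i j) μ * x + c * x.im * (1 : Matrix (Fin n) (Fin n) ℂ) i j) := by
    intro i j u x
    have heq : (fun ν => chernConnection H ν u i j) =ᶠ[nhds μ] fun ν =>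
        u * (Q ν i j + c * ν.im * (1 : Matrix (Fin n) (Fin n) ℂ) i j) := by
      filter_upwards [hV.mem_nhds hμ] with ν hν
      rw [hconn ν hν]
      simp only [Matrix.smul_apply, Matrix.add_apply, smul_eq_mul]
    have h1 := ((((hQd i j).restrictScalars ℝ).hasFDerivAt).fun_add
      (((hasFDerivAt_im_ofReal μ).const_mul c).mul_const
        ((1 : Matrix (Fin n) (Fin n) ℂ) i j))).const_mul u
    rw [heq.fderiv_eq, h1.fderiv, smul_apply, add_apply,
      fderiv_real_of_holomorphic (hQd i j)]
    simp [mul_comm]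
  have hcomm : chernConnection H μ v * chernConnection H μ w -
      chernConnection H μ w * chernConnection H μ v = 0 := by
    rw [hconn μ hμ, hconn μ hμ, Matrix.smul_mul, Matrix.mul_smul, Matrix.smul_mul,
      Matrix.mul_smul, smul_comm, sub_self]
  rw [chernCurvature, hcomm, sub_zero]
  ext i j
  rw [Matrix.of_apply, extDer, hfd, hfd, Matrix.smul_apply, smul_eq_mul, dWedgeDbar, hc]
  have hcj : ∀ u : ℂ, conj u = u - 2 * u.im * Complex.I := fun u => by
    apply Complex.ext <;> simp; ring
  rw [hcj v, hcj w]
  ring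

end Twisted

end ThetaTorus

end

theorem mainTheorem6 (δ : ℕ) [NeZero δ] (τ : UpperHalfPlane) :
    -- `E'` is a holomorphic vector bundle of rank `δ` over `M`
    (∀ p : ThetaTorus.Torus δ τ, ∃ U : Set (ThetaTorus.Torus δ τ), IsOpen U ∧ p ∈ U ∧
      ∃ s : Fin δ → ℂ × ℂ → ℂ, ThetaTorus.IsFrame U s) ∧
    -- in every local holomorphic frame
    (∀ (U : Set (ThetaTorus.Torus δ τ)) (s : Fin δ → ℂ × ℂ → ℂ), IsOpen U →
      ThetaTorus.IsFrame U s →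
      -- `h_{E'}` is a smooth Hermitian metric
      (∀ i j, ContDiffOn ℝ ∞ (fun μ => ThetaTorus.gram δ τ s μ i j) (ThetaTorus.lift U)) ∧
      (∀ μ ∈ ThetaTorus.lift U, (ThetaTorus.gram δ τ s μ).PosDef) ∧
      -- its curvature is `-Θ_{L₀} Id`
      (∀ μ ∈ ThetaTorus.lift U, ∀ v w : ℂ,
        ThetaTorus.chernCurvature (ThetaTorus.gram δ τ s) μ v w =
          (-(ThetaTorus.metricL₀ δ τ).curvature μ v w) • (1 : Matrix (Fin δ) (Fin δ) ℂ))) ∧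
    -- and `-Θ_{L₀} = -(π / τ₂) dμ ∧ dμ̄`
    (∀ μ v w : ℂ, -(ThetaTorus.metricL₀ δ τ).curvature μ v w =
      -(Real.pi / τ.im : ℂ) * ThetaTorus.dWedgeDbar v w) := by
  refine ⟨fun p => ?_, fun U s hU hs => ⟨fun i j => ?_, fun μ hμ => hs.posDef_gram hμ,
    fun μ hμ v w => ?_⟩, fun μ v w => ?_⟩
  · obtain ⟨p, rfl⟩ := QuotientAddGroup.mk_surjective p
    exact ⟨_, ThetaTorus.isOpen_annulus δ τ p, ThetaTorus.mk_mem_annulus δ τ p, _,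
      ThetaTorus.isFrame_thetaFrame δ τ p⟩
  · exact ThetaTorus.contDiffOn_twisted (ThetaTorus.isOpen_lift hU)
      hs.differentiableOn_frameMatrix (fun μ hμ => hs.gram_eq hμ) i j
  · rw [ThetaTorus.chernCurvature_twisted (ThetaTorus.isOpen_lift hU)
      hs.differentiableOn_frameMatrix (fun μ hμ => hs.gram_eq hμ)
      (fun ν hν => (hs.posDef_gram hν).det_pos.ne') hμ, ThetaTorus.curvature_metricL₀, neg_mul]
  · rw [ThetaTorus.curvature_metricL₀, neg_mul]
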